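/- Let $\mathbb{D}$ be the open unit disc, $m=|\cdot|$ normalized Lebesgue measure on the unit circle $\partial\mathbb{D}$, and $dA$ area measure on $\mathbb{C}$. Write $E+t=\{e^{i(s+t)}: e^{is}\in E\}$ and let $\triangle$ denote symmetric difference. A set $K\subseteq\partial\mathbb{D}$ is almost contained in $E\subseteq\partial\mathbb{D}$ if $|K\setminus E|=0$. A compact set $K\subset\mathbb{C}$ is removable for $W^1_a$ if every holomorphic $f$ on $\mathbb{C}\setminus K$ with $\int_{\mathbb{C}\setminus K}|f'|\,dA<\infty$ is constant. Let $\mathcal{B}_0$ be the little Bloch space of holomorphic $f$ on $\mathbb{D}$ with $\lim_{|z|\to1-}(1-|z|)f'(z)=0$, with norm $|f(0)|+\sup_{z\in\mathbb{D}}(1-|z|)|f'(z)|$. A measurable set $E\subseteq\partial\mathbb{D}$ is a set of rigidity for $\mathcal{B}_0$ if the projection $(f,g)\mapsto f$ is injective on the closure of $\{(Q,Q): Q \text{ an analytic polynomial}\}$ in $\mathcal{B}_0\oplus L^\infty(E)$, where $\mathcal{B}_0$ carries its norm topology and $L^\infty(E)$ the weak-star topology as the dual of $L^1(E)$. A compact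 set $K\subseteq\partial\mathbb{D}$ has finite Beurling–Carleson entropy if $\sum_k |I_k|\log\frac{1}{|I_k|}<\infty$, where $\{I_k\}$ are the connected components of $\partial\mathbb{D}\setminus K$. **Proposition.** Let $E\subseteq\partial\mathbb{D}$ be a Lebesgue measurable set with $$\int_0^1 |(E+t)\,\triangle\, E|\,\frac{dt}{t}<\infty .\qquad (*)$$ Then $E$ is a set of rigidity for $\mathcal{B}_0$, and if $|E|>0$, then $E$ almost contains a compact set $K\subseteq\partial\mathbb{D}$ which is not removable for $W^1_a$. In particular, every compact set $K\subseteq\partial\mathbb{D}$ of finite Beurling–Carleson entropy satisfies $(*)$ and is a set of rigidity for $\mathcal{B}_0$, and if $|K|>0$, then $K$ itself is not removable for $W^1_a$. -/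

import Mathlib

open MeasureTheory Filter Topology

namespace BlochRigidity

/-- The Borel sigma-algebra on the unit circle. -/
noncomputable instance instMeasurableSpaceCircle : MeasurableSpace Circle := borel Circle

instance instBorelSpaceCircle : BorelSpace Circle := ⟨rfl⟩

/-- Normalized Lebesgue (arc length) measure `dm` on the unit circle: the image of the normalized
Lebesgue measure on `ℝ / 2πℤ` under `θ ↦ exp (iθ)`. -/
noncomputable def circleMeasure : Measure Circle :=
  haveI : Fact (0 < 2 * Real.pi) := ⟨Real.two_pi_pos⟩
  (AddCircle.haarAddCircle (T := 2 * Real.pi)).map AddCircle.toCircle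

/-- The circleTranslate `E + t = {exp (i(s + t)) : exp (is) ∈ E}`. -/
def circleTranslate (E : Set Circle) (t : ℝ) : Set Circle :=
  (fun ζ => Circle.exp t * ζ) '' E

/-- `∫₀¹ |(E + t) △ E| dt / t`, with values in `[0, ∞]`. -/
noncomputable def translationIntegral (E : Set Circle) : ENNReal :=
  ∫⁻ t in Set.Ioo (0 : ℝ) 1, circleMeasure (symmDiff (circleTranslate E t) E) / ENNReal.ofReal t

/-- `K` is almost contained in `E`. -/
def AlmostContained (K E : Set Circle) : Prop :=
  circleMeasure (K \ E) = 0

/-- The analytic Sobolev space `W¹ₐ(Ω)`: functions holomorphic in `Ω` whose derivative is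
integrable over `Ω` for area measure. -/
def MemAnalyticSobolev (Ω : Set ℂ) (f : ℂ → ℂ) : Prop :=
  DifferentiableOn ℂ f Ω ∧ ∫⁻ z in Ω, ‖deriv f z‖ₑ < ⊤

/-- `K` is removable for `W¹ₐ`: the space `W¹ₐ(ℂ \ K)` consists of constants only. -/
def IsRemovable (K : Set ℂ) : Prop :=
  ∀ f : ℂ → ℂ, MemAnalyticSobolev Kᶜ f → ∃ c : ℂ, ∀ z ∈ Kᶜ, f z = c

/-- The Bloch norm `|f 0| + sup_{|z| < 1} (1 - |z|) |f' z|`, with values in `[0, ∞]`.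
It depends only on the values of `f` in the open unit disc. -/
noncomputable def blochNorm (f : ℂ → ℂ) : ENNReal :=
  ‖f 0‖ₑ + ⨆ z ∈ Metric.ball (0 : ℂ) 1, ENNReal.ofReal ((1 - ‖z‖) * ‖deriv f z‖)

/-- The little Bloch space `ℬ₀`: functions holomorphic in the unit disc with
`(1 - |z|) f' z → 0` as `|z| → 1-`. -/
def MemLittleBloch (f : ℂ → ℂ) : Prop :=
  DifferentiableOn ℂ f (Metric.ball 0 1) ∧
    Tendsto (fun z : ℂ => (1 - ‖z‖) * ‖deriv f z‖) (comap norm (𝓝[<] (1 : ℝ))) (𝓝 0)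

/-- `(f, g)` lies in `𝒫_E(ℬ₀)`, the closure of `{(Q, Q) : Q a polynomial}` in
`ℬ₀ ⊕ L^∞(E)` for the product of the norm topology of `ℬ₀` and the weak-star topology of `L^∞(E)`
(the dual of `L¹(E)`): every basic neighbourhood of `(f, g)`, given by a finite set `s` of functions
in `L¹(E)` and an `ε > 0`, contains some `(Q, Q)`. -/
def MemPolyClosure (E : Set Circle) (f : ℂ → ℂ) (g : Circle → ℂ) : Prop :=
  MemLittleBloch f ∧ MemLp g ⊤ (circleMeasure.restrict E) ∧
    ∀ s : Finset (Circle → ℂ), (∀ h ∈ s, Integrable h (circleMeasure.restrict E)) →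
      ∀ ε : ℝ, 0 < ε → ∃ Q : Polynomial ℂ,
        blochNorm (fun z => Q.eval z - f z) < ENNReal.ofReal ε ∧
        ∀ h ∈ s, ‖∫ ζ in E, (Q.eval (ζ : ℂ) - g ζ) * h ζ ∂circleMeasure‖ < ε

/-- `E` is a set of rigidity for `ℬ₀`: the projection `(f, g) ↦ f` from `𝒫_E(ℬ₀)` to `ℬ₀` is
injective. Elements of `ℬ₀` are functions on the disc, elements of `L^∞(E)` are functions on `E`
up to almost everywhere equality. -/
def IsSetOfRigidity (E : Set Circle) : Prop :=
  ∀ (f₁ f₂ : ℂ → ℂ) (g₁ g₂ : Circle → ℂ),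
    MemPolyClosure E f₁ g₁ → MemPolyClosure E f₂ g₂ →
      Set.EqOn f₁ f₂ (Metric.ball 0 1) → g₁ =ᵐ[circleMeasure.restrict E] g₂

/-- The connected components of `∂𝔻 \ K`. -/
def complementaryArcs (K : Set Circle) : Set (Set Circle) :=
  {I | ∃ ζ ∈ Kᶜ, I = connectedComponentIn Kᶜ ζ}

/-- `K` has finite Beurling-Carleson entropy: it is compact and `∑ |Iₖ| log (1 / |Iₖ|) < ∞`,
the sum over the connected components `Iₖ` of `∂𝔻 \ K`. The terms are nonnegative, as `|·|` is
normalized. -/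
def HasFiniteEntropy (K : Set Circle) : Prop :=
  IsCompact K ∧
    ∑' I : complementaryArcs K, ENNReal.ofReal
      (circleMeasure.real (I : Set Circle) * Real.log (1 / circleMeasure.real (I : Set Circle))) < ⊤

end BlochRigidity

/-!
The condition on `E` says that `1_E` satisfies an `L¹` Dini condition (`IsDini`). For a bounded
density `φ` with this property, differentiated Cauchy-type kernels have mean zero, so that
integrals against them only see the increments of `φ`; as `∫ |ξ - r|⁻² dr = O(1 / |ξ - 1|)`, the
Dini condition bounds the resulting integrals over the disc (`IsDini.lintegral_kernel_lt_top`).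

Applied to the Cauchy transform, this gives a function with integrable derivative off the support
of the density. It is nonconstant as soon as the density is nonzero, and a correcting factor makes
the derivative integrable at infinity as well
(`not_isRemovable_of_isDini_of_integral_ne_zero`). Applied to a Littlewood–Paley type formula for
`∫ Q φ dm`, it bounds this integral by the Bloch norm of the polynomial `Q`
(`enorm_integral_eval_mul_le`). With `φ = 1_E ζⁿ` this determines the Fourier coefficients of
`1_E g` from `f` for every `(f, g)` in the closure, which is rigidity.

The support of `1_E` need not be almost contained in `E`, so the transform of `1_E` itself may have
too many singularities. A compact set almost contained in `E` and carrying a Dini density is found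
by multiplying `1_E` by cutoffs of its averages at a sparse sequence of dyadic scales
(`exists_isDini_of_compact`). The cost of a cutoff at the scale `2⁻ⁿ` is the tail of the Dini
integral below that scale plus a multiple of `n * a n`, where `a n` is its piece at that scale; as
the pieces are summable, both are small along a subsequence.

For a compact set `K` of finite entropy, a point of `K + t` outside `K` lies in a complementary arc
`I` and within `t` of its end, so `|(K + t) △ K| ≤ 2 ∑ min(|I|, t)`; integrating against `dt / t`
gives `∑ (|I| + |I| log (1 / |I|))`.
-/

namespace BlochRigidity

/-! ### Normalized Lebesgue measure on the circle -/

theorem measurableEmbedding_toCircle :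
    MeasurableEmbedding (AddCircle.toCircle (T := 2 * Real.pi)) := by
  have h := (AddCircle.homeomorphCircle (T := 2 * Real.pi) Real.two_pi_pos.ne').measurableEmbedding
  rwa [show ⇑(AddCircle.homeomorphCircle (T := 2 * Real.pi) Real.two_pi_pos.ne') =
    AddCircle.toCircle from funext fun x => AddCircle.homeomorphCircle_apply _ x] at h

theorem lintegral_circleMeasure (F : Circle → ENNReal) :
    ∫⁻ ζ, F ζ ∂circleMeasure =
      ENNReal.ofReal (2 * Real.pi)⁻¹ *
        ∫⁻ θ in Set.Ioc (-Real.pi) Real.pi, F (Circle.exp θ) := by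
  have : Fact (0 < 2 * Real.pi) := ⟨Real.two_pi_pos⟩
  have h1 := AddCircle.lintegral_preimage (2 * Real.pi) (-Real.pi)
    (fun x : AddCircle (2 * Real.pi) => F x.toCircle)
  have h2 : ∀ θ : ℝ, AddCircle.toCircle (θ : AddCircle (2 * Real.pi)) = Circle.exp θ := by
    intro θ
    rw [AddCircle.toCircle_apply_mk, div_self Real.two_pi_pos.ne', one_mul]
  simp only [h2] at h1
  rw [show -Real.pi + 2 * Real.pi = Real.pi by ring] at h1
  rw [circleMeasure, measurableEmbedding_toCircle.lintegral_map, h1,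
    AddCircle.volume_eq_smul_haarAddCircle, lintegral_smul_measure, smul_eq_mul, ← mul_assoc,
    ← ENNReal.ofReal_mul (by positivity), inv_mul_cancel₀ Real.two_pi_pos.ne', ENNReal.ofReal_one,
    one_mul]

instance : IsProbabilityMeasure circleMeasure := by
  have : Fact (0 < 2 * Real.pi) := ⟨Real.two_pi_pos⟩
  exact Measure.isProbabilityMeasure_map measurableEmbedding_toCircle.measurable.aemeasurable

instance : circleMeasure.IsMulLeftInvariant := by
  have : Fact (0 < 2 * Real.pi) := ⟨Real.two_pi_pos⟩
  refine ⟨fun ξ => ?_⟩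
  obtain ⟨x, rfl⟩ := (AddCircle.homeomorphCircle (T := 2 * Real.pi)
    Real.two_pi_pos.ne').surjective ξ
  rw [circleMeasure, Measure.map_map (by fun_prop) measurableEmbedding_toCircle.measurable]
  have : (fun ζ => (AddCircle.homeomorphCircle (T := 2 * Real.pi) Real.two_pi_pos.ne') x * ζ) ∘
      AddCircle.toCircle = AddCircle.toCircle ∘ (fun y => x + y) := by
    ext y
    simp [AddCircle.homeomorphCircle_apply, AddCircle.toCircle_add]
  rw [this, ← Measure.map_map measurableEmbedding_toCircle.measurable (by fun_prop),
    map_add_left_eq_self]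

instance : circleMeasure.IsInvInvariant := by
  have : Fact (0 < 2 * Real.pi) := ⟨Real.two_pi_pos⟩
  refine ⟨?_⟩
  rw [Measure.inv, circleMeasure,
    Measure.map_map (by fun_prop) measurableEmbedding_toCircle.measurable]
  have : Inv.inv ∘ AddCircle.toCircle = AddCircle.toCircle (T := 2 * Real.pi) ∘ Neg.neg := by
    ext y
    simp [AddCircle.toCircle_neg]
  rw [this, ← Measure.map_map measurableEmbedding_toCircle.measurable (by fun_prop)]
  congr 1
  exact Measure.map_neg_eq_self _

theorem measurable_circle_coe : Measurable (fun ζ : Circle => (ζ : ℂ)) :=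
  (by fun_prop : Continuous (fun ζ : Circle => (ζ : ℂ))).measurable

theorem measurable_circle_exp : Measurable fun t : ℝ => Circle.exp t :=
  (by fun_prop : Continuous fun t : ℝ => Circle.exp t).measurable

/-- Orthogonality of the characters, from invariance under a rotation `ξ` with `ξⁿ = -1`. -/
theorem integral_circle_zpow (n : ℤ) :
    ∫ ζ : Circle, (ζ : ℂ) ^ n ∂circleMeasure = if n = 0 then 1 else 0 := by
  split_ifs with h
  · simp [h]
  · have hξ : ((Circle.exp (Real.pi / n) : Circle) : ℂ) ^ n = -1 := by
      rw [Circle.coe_exp, ← Complex.exp_int_mul]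
      push_cast
      rw [show (n : ℂ) * (Real.pi / n * Complex.I) = Real.pi * Complex.I by
        have : (n : ℂ) ≠ 0 := by exact_mod_cast h
        field_simp, Complex.exp_pi_mul_I]
    have h1 := integral_mul_left_eq_self (μ := circleMeasure) (fun ζ : Circle => (ζ : ℂ) ^ n)
      (Circle.exp (Real.pi / n))
    simp only [Circle.coe_mul, mul_zpow, hξ] at h1
    rw [integral_const_mul] at h1
    linear_combination (-1 / 2 : ℂ) * h1

theorem ae_eq_zero_of_forall_integral_zpow_eq_zero {σ : Circle → ℂ}
    (hσ : MemLp σ ⊤ circleMeasure)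
    (h : ∀ n : ℤ, ∫ ζ : Circle, σ ζ * (ζ : ℂ) ^ n ∂circleMeasure = 0) :
    σ =ᵐ[circleMeasure] 0 := by
  have : Fact (0 < 2 * Real.pi) := ⟨Real.two_pi_pos⟩
  have h2 : MemLp σ 2 circleMeasure := hσ.mono_exponent le_top
  have h3 : MemLp (σ ∘ AddCircle.toCircle (T := 2 * Real.pi)) 2 AddCircle.haarAddCircle :=
    (measurableEmbedding_toCircle.memLp_map_measure_iff (p := 2)).1 h2
  have h4 : h3.toLp = 0 := by
    apply (fourierBasis (T := 2 * Real.pi)).repr.injective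
    rw [map_zero]
    ext n
    rw [fourierBasis_repr, fourierCoeff_congr_ae h3.coeFn_toLp]
    have h5 := h (-n)
    rw [circleMeasure, measurableEmbedding_toCircle.integral_map] at h5
    rw [fourierCoeff]
    simp only [fourier_apply, AddCircle.toCircle_zsmul, Circle.coe_zpow, smul_eq_mul]
    simpa [mul_comm] using h5
  have h5 : σ ∘ AddCircle.toCircle (T := 2 * Real.pi) =ᵐ[AddCircle.haarAddCircle] 0 := by
    rw [← MemLp.toLp_eq_toLp_iff h3 MemLp.zero, h4, MemLp.toLp_zero]
  exact (measurableEmbedding_toCircle.ae_map_iff).2 h5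

/-- The bound is `t`, not `t / π`: the constant plays no role. -/
theorem circleMeasure_arc_le {t : ℝ} (ht : 0 ≤ t) (ξ : Circle) :
    circleMeasure {ζ : Circle | |Complex.arg ((ξ⁻¹ * ζ : Circle) : ℂ)| ≤ t} ≤ ENNReal.ofReal t := by
  have hm : MeasurableSet {ζ : Circle | |Complex.arg (ζ : ℂ)| ≤ t} :=
    measurableSet_le (Complex.measurable_arg.comp measurable_circle_coe).abs measurable_const
  have h1 : {ζ : Circle | |Complex.arg ((ξ⁻¹ * ζ : Circle) : ℂ)| ≤ t} =
      (fun ζ => ξ⁻¹ * ζ) ⁻¹' {ζ : Circle | |Complex.arg (ζ : ℂ)| ≤ t} := rfl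
  rw [h1, measure_preimage_mul, ← lintegral_indicator_one hm, lintegral_circleMeasure]
  have h2 : ∫⁻ θ in Set.Ioc (-Real.pi) Real.pi,
      Set.indicator {ζ : Circle | |Complex.arg (ζ : ℂ)| ≤ t} (1 : Circle → ENNReal) (Circle.exp θ)
      ≤ ENNReal.ofReal (2 * t) := by
    calc _ ≤ ∫⁻ θ in Set.Ioc (-Real.pi) Real.pi, Set.indicator (Set.Icc (-t) t) 1 θ := by
            refine setLIntegral_mono' measurableSet_Ioc fun θ hθ => ?_
            simp only [Set.indicator, Set.mem_ofPred_eq, Circle.arg_exp hθ.1 hθ.2, Set.mem_Icc,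
              abs_le, Pi.one_apply]
            rfl
      _ ≤ ∫⁻ θ, Set.indicator (Set.Icc (-t) t) 1 θ := setLIntegral_le_lintegral _ _
      _ = ENNReal.ofReal (2 * t) := by
            rw [lintegral_indicator_one measurableSet_Icc, Real.volume_Icc]
            congr 1; ring
  calc _ ≤ ENNReal.ofReal (2 * Real.pi)⁻¹ * ENNReal.ofReal (2 * t) := by gcongr
    _ = ENNReal.ofReal ((2 * Real.pi)⁻¹ * (2 * t)) := (ENNReal.ofReal_mul (by positivity)).symm
    _ ≤ ENNReal.ofReal t := by
        apply ENNReal.ofReal_le_ofReal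
        rw [mul_inv, ← mul_assoc, mul_right_comm, mul_comm (2⁻¹ : ℝ), mul_assoc, mul_assoc]
        have : Real.pi⁻¹ ≤ 1 := inv_le_one_of_one_le₀ (by linarith [Real.pi_gt_three])
        nlinarith

instance : NullSingletonClass circleMeasure := by
  refine ⟨fun ξ => le_antisymm ?_ zero_le⟩
  refine (measure_mono ?_).trans (circleMeasure_arc_le le_rfl ξ) |>.trans (by simp)
  rintro _ rfl
  simp

/-! ### The `L¹` modulus of continuity and the Dini condition -/

/-- The `L¹` modulus of continuity `∫ |φ(ξζ) - φ(ζ)| dm(ζ)` of `φ`, as a function of the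
rotation `ξ`. -/
noncomputable def modulus (φ : Circle → ℂ) (ξ : Circle) : ENNReal :=
  ∫⁻ ζ, ‖φ (ξ * ζ) - φ ζ‖ₑ ∂circleMeasure

/-- The `L¹` Dini condition: the modulus of continuity is integrable against `dt / t`. For the
indicator function of a set `E` this is the finiteness of `translationIntegral E`. -/
def IsDini (φ : Circle → ℂ) : Prop :=
  ∫⁻ t in Set.Ioo (0 : ℝ) 1, modulus φ (Circle.exp t) / ENNReal.ofReal t < ⊤

theorem modulus_inv (φ : Circle → ℂ) (ξ : Circle) : modulus φ ξ⁻¹ = modulus φ ξ := by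
  rw [modulus, modulus, ← lintegral_mul_left_eq_self _ ξ]
  simp only [inv_mul_cancel_left]
  exact lintegral_congr fun ζ => enorm_sub_rev _ _

@[simp] theorem modulus_one (φ : Circle → ℂ) : modulus φ 1 = 0 := by
  simp [modulus]

theorem measurable_modulus {φ : Circle → ℂ} (hφ : Measurable φ) : Measurable (modulus φ) := by
  refine Measurable.lintegral_prod_right' (ν := circleMeasure)
    (f := fun p : Circle × Circle => ‖φ (p.1 * p.2) - φ p.2‖ₑ) ?_
  fun_prop

theorem modulus_le {φ : Circle → ℂ} {C : ℝ} (hC : ∀ ζ, ‖φ ζ‖ ≤ C) (ξ : Circle) :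
    modulus φ ξ ≤ ENNReal.ofReal (2 * C) := by
  calc modulus φ ξ ≤ ∫⁻ _, ENNReal.ofReal (2 * C) ∂circleMeasure := by
        refine lintegral_mono fun ζ => ?_
        rw [← ofReal_norm]
        exact ENNReal.ofReal_le_ofReal ((norm_sub_le _ _).trans (by linarith [hC ζ, hC (ξ * ζ)]))
    _ = _ := by simp

theorem norm_exp_sub_one_ge {θ : ℝ} (h : |θ| ≤ Real.pi) :
    |θ| / 2 ≤ ‖(Circle.exp θ : ℂ) - 1‖ := by
  rw [Circle.coe_exp, mul_comm, Complex.norm_exp_I_mul_ofReal_sub_one, norm_mul, Real.norm_eq_abs,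
    Real.norm_eq_abs, abs_two]
  have h1 : |Real.sin (θ / 2)| = Real.sin (|θ| / 2) := by
    rcases abs_cases θ with ⟨h2, h3⟩ | ⟨h2, h3⟩
    · rw [h2, abs_of_nonneg]
      exact Real.sin_nonneg_of_nonneg_of_le_pi (by linarith) (by linarith [Real.pi_pos])
    · rw [h2, neg_div, Real.sin_neg, abs_of_nonpos]
      exact Real.sin_nonpos_of_nonpos_of_neg_pi_le (by linarith) (by linarith [Real.pi_pos])
  rw [h1]
  have h2 := Real.mul_le_sin (x := |θ| / 2) (by positivity) (by linarith)
  have h3 : (1 / 2 : ℝ) ≤ 2 / Real.pi := by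
    rw [div_le_div_iff₀ (by norm_num) Real.pi_pos]; linarith [Real.pi_lt_four]
  have h4 := mul_le_mul_of_nonneg_right h3 (by positivity : 0 ≤ |θ| / 2)
  linarith

/-- The Dini condition over the whole circle, with the chord `|ξ - 1|` in place of `t`. -/
theorem IsDini.lintegral_div_lt_top {φ : Circle → ℂ} (hφ : Measurable φ) {C : ℝ}
    (hC : ∀ ζ, ‖φ ζ‖ ≤ C) (hd : IsDini φ) :
    ∫⁻ ξ : Circle, modulus φ ξ / ‖(ξ : ℂ) - 1‖ₑ ∂circleMeasure < ⊤ := by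
  have hm := measurable_modulus hφ
  rw [lintegral_circleMeasure]
  refine ENNReal.mul_lt_top ENNReal.ofReal_lt_top ?_
  -- The Dini integrand, up to the comparison of `|e^{it} - 1|` with `|t|`; it is used for `θ` and
  -- for `-θ`, and `|θ| ≥ 1` contributes a bounded term.
  set G : ℝ → ENNReal := (Set.Ioo (0 : ℝ) 1).indicator
    (fun t => 2 * (modulus φ (Circle.exp t) / ENNReal.ofReal t)) with hG
  have hGm : Measurable G := by
    refine Measurable.indicator ?_ measurableSet_Ioo
    have : Measurable fun t : ℝ => modulus φ (Circle.exp t) :=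
      hm.comp measurable_circle_exp
    fun_prop
  have hGi : ∫⁻ t, G t < ⊤ := by
    rw [hG, lintegral_indicator measurableSet_Ioo, lintegral_const_mul' _ _ (by simp)]
    exact ENNReal.mul_lt_top (by simp) hd
  have key : ∀ s : ℝ, 0 < s → s ≤ Real.pi →
      modulus φ (Circle.exp s) / ENNReal.ofReal (s / 2) ≤ G s + ENNReal.ofReal (4 * C) := by
    intro s hs hsπ
    by_cases h1 : s < 1
    · refine le_add_right ?_
      rw [hG, Set.indicator_of_mem (Set.mem_Ioo.2 ⟨hs, h1⟩),
        ENNReal.ofReal_div_of_pos (by norm_num)]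
      simp only [div_eq_mul_inv]
      rw [ENNReal.mul_inv (by simp) (by simp), inv_inv, ENNReal.ofReal_ofNat]
      apply le_of_eq; ring
    · refine le_add_left ?_
      rw [ENNReal.div_le_iff (by simpa using hs) (by simp),
        ← ENNReal.ofReal_mul' (by positivity)]
      refine (modulus_le hC _).trans (ENNReal.ofReal_le_ofReal ?_)
      have : 0 ≤ C := (norm_nonneg _).trans (hC 1)
      nlinarith
  calc ∫⁻ θ in Set.Ioc (-Real.pi) Real.pi,
        modulus φ (Circle.exp θ) / ‖(Circle.exp θ : ℂ) - 1‖ₑ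
      ≤ ∫⁻ θ in Set.Ioc (-Real.pi) Real.pi, (G θ + G (-θ) + ENNReal.ofReal (4 * C)) := by
        refine setLIntegral_mono' measurableSet_Ioc fun θ hθ => ?_
        have habs : |θ| ≤ Real.pi := abs_le.2 ⟨hθ.1.le, hθ.2⟩
        have h2 : modulus φ (Circle.exp θ) / ‖(Circle.exp θ : ℂ) - 1‖ₑ ≤
            modulus φ (Circle.exp θ) / ENNReal.ofReal (|θ| / 2) := by
          refine ENNReal.div_le_div_left ?_ _
          rw [← ofReal_norm]
          exact ENNReal.ofReal_le_ofReal (norm_exp_sub_one_ge habs)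
        refine h2.trans ?_
        rcases lt_trichotomy θ 0 with h | h | h
        · rw [abs_of_neg h] at habs ⊢
          have h3 := key (-θ) (by linarith) habs
          rw [Circle.exp_neg, modulus_inv] at h3
          refine h3.trans ?_
          gcongr
          exact le_add_self
        · simp [h]
        · rw [abs_of_pos h] at habs ⊢
          refine (key θ h habs).trans ?_
          gcongr
          exact le_self_add
    _ = (∫⁻ θ in Set.Ioc (-Real.pi) Real.pi, G θ) + (∫⁻ θ in Set.Ioc (-Real.pi) Real.pi, G (-θ)) +
          ENNReal.ofReal (4 * C) * volume (Set.Ioc (-Real.pi) Real.pi) := by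
        rw [lintegral_add_right _ measurable_const, lintegral_add_left hGm, setLIntegral_const]
    _ ≤ (∫⁻ θ, G θ) + (∫⁻ θ, G (-θ)) +
          ENNReal.ofReal (4 * C) * volume (Set.Ioc (-Real.pi) Real.pi) := by
        gcongr <;> exact Measure.restrict_le_self
    _ < ⊤ := by
        rw [lintegral_neg_eq_self]
        simp [hGi, ENNReal.mul_lt_top]

theorem norm_sub_one_le_two_mul_norm_sub (ξ : Circle) {r : ℝ} (hr : 0 ≤ r) :
    ‖(ξ : ℂ) - 1‖ ≤ 2 * ‖(ξ : ℂ) - r‖ ∧ |r - 1| ≤ ‖(ξ : ℂ) - r‖ := by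
  have h1 : |r - 1| ≤ ‖(ξ : ℂ) - r‖ := by
    have := abs_norm_sub_norm_le (r : ℂ) ξ
    rwa [Circle.norm_coe, Complex.norm_real, Real.norm_eq_abs, abs_of_nonneg hr,
      norm_sub_rev] at this
  refine ⟨?_, h1⟩
  have h2 : ‖(ξ : ℂ) - 1‖ ≤ ‖(ξ : ℂ) - r‖ + ‖(r : ℂ) - 1‖ := norm_sub_le_norm_sub_add_norm_sub _ _ _
  have h3 : ‖(r : ℂ) - 1‖ = |r - 1| := by
    rw [← Complex.ofReal_one, ← Complex.ofReal_sub, Complex.norm_real, Real.norm_eq_abs]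
  linarith

/-- Integrating `|ξ - r|⁻²` over the radius gives `O(1 / |ξ - 1|)`, since `|ξ - r|` dominates both
`|ξ - 1| / 2` and `|r - 1|`. This is what turns the weight `1 / t` into an area integral. -/
theorem lintegral_radial_le (ξ : Circle) :
    ∫⁻ r in Set.Ioo (0 : ℝ) 2, (‖(ξ : ℂ) - (r : ℝ)‖ₑ ^ 2)⁻¹ ≤
      ENNReal.ofReal (4 * Real.pi) / ‖(ξ : ℂ) - 1‖ₑ := by
  by_cases hξ : (ξ : ℂ) - 1 = 0
  · rw [hξ, enorm_zero, ENNReal.div_zero (by simp [Real.pi_pos])]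
    exact le_top
  set a : ℝ := ‖(ξ : ℂ) - 1‖ / 2 with ha
  have ha0 : 0 < a := by have := norm_pos_iff.2 hξ; positivity
  have hint : Integrable fun r : ℝ => 2 / a ^ 2 * (1 + ((r - 1) / a) ^ 2)⁻¹ := by
    have := ((integrable_inv_one_add_sq.comp_div ha0.ne').comp_sub_right 1).const_mul (2 / a ^ 2)
    simpa using this
  have hval : ∫ r : ℝ, 2 / a ^ 2 * (1 + ((r - 1) / a) ^ 2)⁻¹ = 4 * Real.pi / ‖(ξ : ℂ) - 1‖ := by
    rw [integral_const_mul, integral_sub_right_eq_self (fun r : ℝ => (1 + (r / a) ^ 2)⁻¹) 1,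
      Measure.integral_comp_div (fun x : ℝ => (1 + x ^ 2)⁻¹) a, integral_univ_inv_one_add_sq,
      abs_of_pos ha0, smul_eq_mul, show ‖(ξ : ℂ) - 1‖ = 2 * a by rw [ha]; ring]
    field_simp
    ring
  calc ∫⁻ r in Set.Ioo (0 : ℝ) 2, (‖(ξ : ℂ) - (r : ℝ)‖ₑ ^ 2)⁻¹
      ≤ ∫⁻ r in Set.Ioo (0 : ℝ) 2,
          ENNReal.ofReal (2 / a ^ 2 * (1 + ((r - 1) / a) ^ 2)⁻¹) := by
        refine setLIntegral_mono' measurableSet_Ioo fun r hr => ?_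
        obtain ⟨h1, h2⟩ := norm_sub_one_le_two_mul_norm_sub ξ hr.1.le
        have h3 : a ≤ ‖(ξ : ℂ) - (r : ℝ)‖ := by rw [ha]; linarith
        have h4 : 0 < ‖(ξ : ℂ) - (r : ℝ)‖ := ha0.trans_le h3
        rw [← ofReal_norm, ← ENNReal.ofReal_pow (norm_nonneg _),
          ← ENNReal.ofReal_inv_of_pos (by positivity)]
        apply ENNReal.ofReal_le_ofReal
        have h5 : 2 / a ^ 2 * (1 + ((r - 1) / a) ^ 2)⁻¹ = ((a ^ 2 + (r - 1) ^ 2) / 2)⁻¹ := by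
          field_simp
        rw [h5]
        apply inv_anti₀ (by positivity)
        have h6 : (r - 1) ^ 2 ≤ ‖(ξ : ℂ) - (r : ℝ)‖ ^ 2 := by
          rw [← sq_abs]; gcongr
        nlinarith
    _ ≤ ∫⁻ r : ℝ, ENNReal.ofReal (2 / a ^ 2 * (1 + ((r - 1) / a) ^ 2)⁻¹) :=
        setLIntegral_le_lintegral _ _
    _ = ENNReal.ofReal (4 * Real.pi / ‖(ξ : ℂ) - 1‖) := by
        rw [← ofReal_integral_eq_lintegral_ofReal hint
          (Eventually.of_forall fun r => by positivity), hval]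
    _ = _ := by
        rw [ENNReal.ofReal_div_of_pos (norm_pos_iff.2 hξ), ofReal_norm]

/-- The form of the Dini condition used for both the Cauchy transform (`0 < r < 2`) and the pairing
with Bloch functions (`0 < r < 1`). -/
theorem IsDini.lintegral_kernel_lt_top {φ : Circle → ℂ} (hφ : Measurable φ) {C : ℝ}
    (hC : ∀ ζ, ‖φ ζ‖ ≤ C) (hd : IsDini φ) :
    ∫⁻ r in Set.Ioo (0 : ℝ) 2, ∫⁻ ξ : Circle, modulus φ ξ * (‖(ξ : ℂ) - (r : ℝ)‖ₑ ^ 2)⁻¹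
      ∂circleMeasure < ⊤ := by
  have hm := measurable_modulus hφ
  have hc := measurable_circle_coe
  rw [lintegral_lintegral_swap]
  · calc ∫⁻ ξ : Circle, (∫⁻ r in Set.Ioo (0 : ℝ) 2, modulus φ ξ * (‖(ξ : ℂ) - (r : ℝ)‖ₑ ^ 2)⁻¹)
          ∂circleMeasure
        ≤ ∫⁻ ξ : Circle, ENNReal.ofReal (4 * Real.pi) * (modulus φ ξ / ‖(ξ : ℂ) - 1‖ₑ)
          ∂circleMeasure := by
          refine lintegral_mono fun ξ => ?_
          rw [lintegral_const_mul' _ _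
            ((modulus_le hC ξ).trans_lt ENNReal.ofReal_lt_top).ne]
          calc _ ≤ modulus φ ξ * (ENNReal.ofReal (4 * Real.pi) / ‖(ξ : ℂ) - 1‖ₑ) := by
                gcongr; exact lintegral_radial_le ξ
            _ = _ := by simp only [div_eq_mul_inv]; ring
      _ < ⊤ := by
          rw [lintegral_const_mul' _ _ ENNReal.ofReal_ne_top]
          exact ENNReal.mul_lt_top ENNReal.ofReal_lt_top (hd.lintegral_div_lt_top hφ hC)
  · apply Measurable.aemeasurable
    fun_prop

/-- Multiplication by a Lipschitz function preserves the Dini condition. -/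
theorem IsDini.mul {φ g : Circle → ℂ} {C B L : ℝ} (hφ : Measurable φ) (hd : IsDini φ)
    (hC : ∀ ζ, ‖φ ζ‖ ≤ C) (hB : ∀ ζ, ‖g ζ‖ ≤ B)
    (hL : ∀ t : ℝ, 0 < t → ∀ ζ, ‖g (Circle.exp t * ζ) - g ζ‖ ≤ L * t) :
    IsDini (fun ζ => φ ζ * g ζ) := by
  have hB0 : 0 ≤ B := (norm_nonneg _).trans (hB 1)
  have hC0 : 0 ≤ C := (norm_nonneg _).trans (hC 1)
  have hL0 : 0 ≤ L := by
    have := (norm_nonneg _).trans (hL 1 one_pos 1); linarith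
  have key : ∀ t : ℝ, 0 < t → modulus (fun ζ => φ ζ * g ζ) (Circle.exp t) ≤
      ENNReal.ofReal B * modulus φ (Circle.exp t) + ENNReal.ofReal (C * (L * t)) := by
    intro t ht
    calc _ ≤ ∫⁻ ζ, (ENNReal.ofReal B * ‖φ (Circle.exp t * ζ) - φ ζ‖ₑ +
            ENNReal.ofReal (C * (L * t))) ∂circleMeasure := by
          refine lintegral_mono fun ζ => ?_
          simp only [← ofReal_norm]
          rw [← ENNReal.ofReal_mul hB0, ← ENNReal.ofReal_add (by positivity) (by positivity)]
          apply ENNReal.ofReal_le_ofReal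
          calc ‖φ (Circle.exp t * ζ) * g (Circle.exp t * ζ) - φ ζ * g ζ‖
              = ‖(φ (Circle.exp t * ζ) - φ ζ) * g (Circle.exp t * ζ) +
                  φ ζ * (g (Circle.exp t * ζ) - g ζ)‖ := by ring_nf
            _ ≤ _ := (norm_add_le _ _)
            _ ≤ _ := by
              rw [norm_mul, norm_mul, mul_comm ‖φ (Circle.exp t * ζ) - φ ζ‖]
              gcongr
              · exact hB _
              · exact hC _
              · exact hL t ht ζ
      _ = _ := by
          rw [lintegral_add_right _ measurable_const, lintegral_const_mul _ (by fun_prop)]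
          simp [modulus]
  have hm : Measurable fun t : ℝ => modulus φ (Circle.exp t) / ENNReal.ofReal t := by
    have : Measurable fun t : ℝ => modulus φ (Circle.exp t) :=
      (measurable_modulus hφ).comp measurable_circle_exp
    fun_prop
  calc _ ≤ ∫⁻ t in Set.Ioo (0 : ℝ) 1,
        (ENNReal.ofReal B * (modulus φ (Circle.exp t) / ENNReal.ofReal t) +
          ENNReal.ofReal (C * L)) := by
        refine setLIntegral_mono' measurableSet_Ioo fun t ht => ?_
        refine (ENNReal.div_le_div_right (key t ht.1) _).trans ?_
        rw [ENNReal.add_div, mul_div_assoc]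
        gcongr
        rw [← mul_assoc, ENNReal.ofReal_mul' ht.1.le, ENNReal.mul_div_cancel_right]
        · simpa using ht.1
        · simp
    _ < ⊤ := by
        rw [lintegral_add_right _ measurable_const, lintegral_const_mul _ hm]
        refine ENNReal.add_lt_top.2 ⟨ENNReal.mul_lt_top (by simp) hd, ?_⟩
        simp

theorem norm_exp_sub_one_le (t : ℝ) : ‖(Circle.exp t : ℂ) - 1‖ ≤ |t| := by
  rw [Circle.coe_exp, mul_comm]
  exact Real.norm_exp_I_mul_ofReal_sub_one_le

theorem mem_circleTranslate {E : Set Circle} {t : ℝ} {ζ : Circle} :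
    ζ ∈ circleTranslate E t ↔ (Circle.exp t)⁻¹ * ζ ∈ E := by
  simp only [circleTranslate, Set.mem_image]
  constructor
  · rintro ⟨x, hx, rfl⟩; simpa
  · intro h; exact ⟨_, h, by simp⟩

theorem circleTranslate_eq_preimage (E : Set Circle) (t : ℝ) :
    circleTranslate E t = (fun ζ => (Circle.exp t)⁻¹ * ζ) ⁻¹' E :=
  Set.ext fun _ => mem_circleTranslate

theorem modulus_indicator {E : Set Circle} (hE : MeasurableSet E) (t : ℝ) :
    modulus (E.indicator 1) (Circle.exp t) =
      circleMeasure (symmDiff (circleTranslate E t) E) := by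
  have h1 := circleTranslate_eq_preimage E t
  have h2 : MeasurableSet (circleTranslate E t) := by
    rw [h1]; exact (measurable_const_mul _) hE
  rw [← lintegral_indicator_one (h2.symmDiff hE), ← modulus_inv, modulus]
  refine lintegral_congr fun ζ => ?_
  rw [h1]
  by_cases ha : (Circle.exp t)⁻¹ * ζ ∈ E <;> by_cases hb : ζ ∈ E <;>
    simp [Set.indicator, Set.mem_symmDiff, ha, hb]

theorem isDini_indicator_iff {E : Set Circle} (hE : MeasurableSet E) :
    IsDini (E.indicator 1) ↔ translationIntegral E < ⊤ := by
  simp only [IsDini, translationIntegral, modulus_indicator hE]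

/-! ### Fourier coefficients of the Cauchy kernel -/

theorem hasSum_succ_mul_geometric {w : ℂ} (hw : ‖w‖ < 1) :
    HasSum (fun k : ℕ => ((k : ℂ) + 1) * w ^ k) ((1 - w) ^ 2)⁻¹ := by
  have h1 : 1 - w ≠ 0 := by
    intro h
    rw [← sub_eq_zero.1 h] at hw
    simp at hw
  have h2 := (hasSum_coe_mul_geometric_of_norm_lt_one hw).add (hasSum_geometric_of_norm_lt_one hw)
  rw [show w / (1 - w) ^ 2 + (1 - w)⁻¹ = ((1 - w) ^ 2)⁻¹ by field_simp; ring] at h2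
  exact h2.congr_fun fun k => by ring

theorem integrable_of_continuous_circle {f : Circle → ℂ} (hf : Continuous f) :
    Integrable f circleMeasure :=
  hf.integrable_of_hasCompactSupport (HasCompactSupport.of_compactSpace f)

theorem integral_zpow_mul_kernel {a : ℂ} (ha : ‖a‖ < 1) (n : ℤ) :
    ∫ ζ : Circle, (ζ : ℂ) ^ n * ((1 - a * ζ) ^ 2)⁻¹ ∂circleMeasure =
      ∑' k : ℕ, ((k : ℂ) + 1) * a ^ k * if n + k = 0 then 1 else 0 := by
  have hcont : ∀ m : ℤ, Continuous fun ζ : Circle => (ζ : ℂ) ^ m := fun m => by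
    have : Continuous fun ζ : Circle => ((ζ ^ m : Circle) : ℂ) :=
      (by fun_prop : Continuous fun ζ : Circle => (ζ : ℂ)).comp (continuous_zpow m)
    simpa using this
  have h := hasSum_integral_of_summable_integral_norm (μ := circleMeasure)
    (F := fun (k : ℕ) (ζ : Circle) => ((k : ℂ) + 1) * a ^ k * (ζ : ℂ) ^ (n + k))
    (fun k => integrable_of_continuous_circle ((hcont _).const_mul _)) (by
      have h1 := (hasSum_succ_mul_geometric (w := (‖a‖ : ℂ)) (by simpa using ha)).summable.norm
      refine h1.congr fun k => ?_
      simp [Circle.norm_coe])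
  simp only [integral_const_mul, integral_circle_zpow] at h
  rw [h.tsum_eq]
  refine integral_congr_ae (Eventually.of_forall fun ζ => ?_)
  have h2 := (hasSum_succ_mul_geometric (w := a * ζ)
    (by simpa [Circle.norm_coe] using ha)).mul_left ((ζ : ℂ) ^ n)
  dsimp only
  rw [← h2.tsum_eq]
  refine tsum_congr fun k => ?_
  rw [mul_pow, zpow_add₀ (Circle.coe_ne_zero ζ), zpow_natCast]
  ring

theorem integral_zpow_neg_mul_kernel {a : ℂ} (ha : ‖a‖ < 1) (k : ℕ) :
    ∫ ζ : Circle, (ζ : ℂ) ^ (-(k : ℤ)) * ((1 - a * ζ) ^ 2)⁻¹ ∂circleMeasure =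
      ((k : ℂ) + 1) * a ^ k := by
  rw [integral_zpow_mul_kernel ha, tsum_eq_single k]
  · simp
  · intro j hj
    rw [if_neg (by omega), mul_zero]

theorem integral_mul_kernel_eq_zero {a : ℂ} (ha : ‖a‖ < 1) :
    ∫ ζ : Circle, (ζ : ℂ) * ((1 - a * ζ) ^ 2)⁻¹ ∂circleMeasure = 0 := by
  have h := integral_zpow_mul_kernel ha 1
  simp only [zpow_one] at h
  rw [h]
  refine (tsum_congr fun k => ?_).trans tsum_zero
  rw [if_neg (by omega), mul_zero]

/-- The cancellation behind the area estimate: the differentiated kernel has mean zero on both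
sides of the circle. -/
theorem integral_div_sub_sq_eq_zero {r : ℝ} (hr : 0 ≤ r) (hr1 : r ≠ 1) :
    ∫ ζ : Circle, (ζ : ℂ) / ((ζ : ℂ) - r) ^ 2 ∂circleMeasure = 0 := by
  rcases lt_or_gt_of_ne hr1 with h | h
  · rw [← integral_inv_eq_self,
      ← integral_mul_kernel_eq_zero (a := (r : ℂ)) (by simpa [abs_of_nonneg hr] using h)]
    refine integral_congr_ae (Eventually.of_forall fun ζ => ?_)
    have h0 := Circle.coe_ne_zero ζ
    dsimp only
    rw [Circle.coe_inv, show (ζ : ℂ)⁻¹ - r = (ζ : ℂ)⁻¹ * (1 - r * ζ) by field_simp]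
    rw [mul_pow, div_eq_mul_inv, mul_inv]
    field_simp
  · have h2 : ‖((r⁻¹ : ℝ) : ℂ)‖ < 1 := by
      rw [Complex.norm_real, Real.norm_eq_abs, abs_of_nonneg (by positivity)]
      exact inv_lt_one_of_one_lt₀ h
    have hr0 : (r : ℂ) ≠ 0 := by
      have : r ≠ 0 := by linarith
      exact_mod_cast this
    have h3 := congrArg (fun x => ((r : ℂ) ^ 2)⁻¹ * x) (integral_mul_kernel_eq_zero h2)
    simp only [mul_zero] at h3
    rw [← integral_const_mul] at h3
    rw [← h3]
    refine integral_congr_ae (Eventually.of_forall fun ζ => ?_)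
    have h4 : (ζ : ℂ) - r = -r * (1 - ((r⁻¹ : ℝ) : ℂ) * ζ) := by
      push_cast; field_simp; ring
    dsimp only
    rw [h4, mul_pow, neg_sq, div_eq_mul_inv, mul_inv]
    ring

theorem coe_sub_ofReal_ne_zero {r : ℝ} (hr : 0 ≤ r) (hr1 : r ≠ 1) (ξ : Circle) :
    (ξ : ℂ) - r ≠ 0 := by
  intro h
  have := (norm_sub_one_le_two_mul_norm_sub ξ hr).2
  rw [h, norm_zero, abs_nonpos_iff, sub_eq_zero] at this
  exact hr1 this

/-! ### The Cauchy transform -/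

/-- The Cauchy transform `∫ σ(ζ) ζ / (ζ - z) dm(ζ)` of a density `σ` on the circle. The extra
factor `ζ` (that is, integration against `dζ` up to a constant) makes the kernel of the derivative
have mean zero on both sides of the circle. -/
noncomputable def cauchyTransform (σ : Circle → ℂ) (z : ℂ) : ℂ :=
  ∫ ζ : Circle, σ ζ * ζ / (ζ - z) ∂circleMeasure

/-- The integral obtained from `cauchyTransform σ` by differentiating under the integral. -/
noncomputable def cauchyTransformDeriv (σ : Circle → ℂ) (z : ℂ) : ℂ :=
  ∫ ζ : Circle, σ ζ * ζ / (ζ - z) ^ 2 ∂circleMeasure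

theorem hasDerivAt_cauchyTransform {σ : Circle → ℂ} (hσ : Measurable σ) {C : ℝ}
    (hC : ∀ ζ, ‖σ ζ‖ ≤ C) {K : Set Circle} (hK : IsCompact K) (hσK : ∀ ζ ∉ K, σ ζ = 0)
    {z : ℂ} (hz : z ∉ (fun ζ : Circle => (ζ : ℂ)) '' K) :
    HasDerivAt (cauchyTransform σ) (cauchyTransformDeriv σ z) z := by
  have hcl : IsClosed ((fun ζ : Circle => (ζ : ℂ)) '' K) := (hK.image (by fun_prop)).isClosed
  obtain ⟨d, hd, hball⟩ := Metric.isOpen_iff.1 hcl.isOpen_compl z hz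
  have hC0 : 0 ≤ C := (norm_nonneg _).trans (hC 1)
  have hfar : ∀ ζ ∈ K, ∀ w ∈ Metric.ball z (d / 2), d / 2 ≤ ‖(ζ : ℂ) - w‖ := by
    intro ζ hζ w hw
    have h1 : d ≤ dist (ζ : ℂ) z := by
      by_contra hcon
      exact hball (Metric.mem_ball.2 (not_le.1 hcon)) ⟨ζ, hζ, rfl⟩
    have h2 := dist_triangle (ζ : ℂ) w z
    rw [Metric.mem_ball] at hw
    rw [← dist_eq_norm]
    linarith
  have hc := measurable_circle_coe
  have hz' : z ∈ Metric.ball z (d / 2) := Metric.mem_ball_self (by positivity)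
  refine (hasDerivAt_integral_of_dominated_loc_of_deriv_le (μ := circleMeasure)
    (F := fun (w : ℂ) (ζ : Circle) => σ ζ * ζ / (ζ - w))
    (F' := fun (w : ℂ) (ζ : Circle) => σ ζ * ζ / (ζ - w) ^ 2)
    (bound := fun _ => C / (d / 2) ^ 2) (s := Metric.ball z (d / 2))
    (Metric.ball_mem_nhds z (by positivity)) ?_ ?_ ?_ ?_ (integrable_const _) ?_).2
  · exact Eventually.of_forall fun w => (by fun_prop : Measurable _).aestronglyMeasurable
  · refine Integrable.of_bound (C := C / (d / 2))
      (by fun_prop : Measurable _).aestronglyMeasurable (Eventually.of_forall fun ζ => ?_)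
    by_cases hζ : ζ ∈ K
    · rw [norm_div, norm_mul, Circle.norm_coe, mul_one]
      have := hfar ζ hζ z hz'
      gcongr
      exact hC ζ
    · simp only [hσK ζ hζ, zero_mul, zero_div, norm_zero]; positivity
  · exact (by fun_prop : Measurable _).aestronglyMeasurable
  · refine Eventually.of_forall fun ζ w hw => ?_
    by_cases hζ : ζ ∈ K
    · rw [norm_div, norm_mul, Circle.norm_coe, mul_one, norm_pow]
      have := hfar ζ hζ w hw
      gcongr
      exact hC ζ
    · simp only [hσK ζ hζ, zero_mul, zero_div, norm_zero]; positivity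
  · refine Eventually.of_forall fun ζ w hw => ?_
    by_cases hζ : ζ ∈ K
    · have h0 : (ζ : ℂ) - w ≠ 0 := by
        have := hfar ζ hζ w hw
        rw [← norm_pos_iff]
        linarith
      have h1 := (((hasDerivAt_id w).const_sub (ζ : ℂ)).inv h0).const_mul (σ ζ * ζ)
      simpa [div_eq_mul_inv] using h1
    · simp only [hσK ζ hζ, zero_mul, zero_div]
      exact hasDerivAt_const _ _

/-- By the mean-zero property, `σ` may be replaced by its increments at the radial projection
`η`. -/
theorem enorm_cauchyTransformDeriv_le {σ : Circle → ℂ} (hσ : Measurable σ) {C : ℝ}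
    (hC : ∀ ζ, ‖σ ζ‖ ≤ C) {r : ℝ} (hr : 0 ≤ r) (hr1 : r ≠ 1) (η : Circle) :
    ‖cauchyTransformDeriv σ (r * η)‖ₑ ≤
      ∫⁻ ξ : Circle, ‖σ (ξ * η) - σ η‖ₑ * (‖(ξ : ℂ) - r‖ₑ ^ 2)⁻¹ ∂circleMeasure := by
  have h0 := coe_sub_ofReal_ne_zero hr hr1
  have hη := Circle.coe_ne_zero η
  have hcont : Continuous fun ξ : Circle => (ξ : ℂ) / ((ξ : ℂ) - r) ^ 2 := by
    refine Continuous.div (by fun_prop) (by fun_prop) fun ξ => pow_ne_zero _ (h0 ξ)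
  have hint := integrable_of_continuous_circle hcont
  have hint2 : Integrable (fun ξ : Circle => σ (ξ * η) * ((ξ : ℂ) / ((ξ : ℂ) - r) ^ 2))
      circleMeasure := hint.bdd_mul (c := C) (by fun_prop : Measurable _).aestronglyMeasurable
        (Eventually.of_forall fun ξ => hC _)
  have h1 : cauchyTransformDeriv σ (r * η) = ∫ ξ : Circle,
      (η : ℂ)⁻¹ * (σ (ξ * η) * ((ξ : ℂ) / ((ξ : ℂ) - r) ^ 2) -
        σ η * ((ξ : ℂ) / ((ξ : ℂ) - r) ^ 2)) ∂circleMeasure := by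
    rw [integral_const_mul, integral_sub hint2 (hint.const_mul _), integral_const_mul,
      integral_div_sub_sq_eq_zero hr hr1, mul_zero, sub_zero, ← integral_const_mul,
      cauchyTransformDeriv, ← integral_mul_left_eq_self _ η]
    refine integral_congr_ae (Eventually.of_forall fun ξ => ?_)
    dsimp only
    rw [mul_comm η ξ, Circle.coe_mul, show (ξ : ℂ) * η - r * η = η * (ξ - r) by ring, mul_pow]
    have := h0 ξ
    field_simp
  rw [h1]
  refine (enorm_integral_le_lintegral_enorm _).trans (lintegral_mono fun ξ => le_of_eq ?_)
  rw [← sub_mul, enorm_mul, enorm_mul, enorm_inv hη, div_eq_mul_inv, enorm_mul,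
    enorm_inv (pow_ne_zero _ (h0 ξ)), enorm_pow]
  have h2 : ∀ ζ : Circle, ‖(ζ : ℂ)‖ₑ = 1 := fun ζ => by
    rw [← ofReal_norm, Circle.norm_coe, ENNReal.ofReal_one]
  simp [h2]

/-- Without the condition `∫ σ(ζ) ζ dm = 0` the derivative only decays like `|z|⁻²`, which is not
integrable at infinity. -/
theorem norm_cauchyTransformDeriv_le {σ : Circle → ℂ} (hσ : Measurable σ) {C : ℝ}
    (hC : ∀ ζ, ‖σ ζ‖ ≤ C) (h0 : ∫ ζ : Circle, σ ζ * ζ ∂circleMeasure = 0) {z : ℂ}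
    (hz : 2 ≤ ‖z‖) : ‖cauchyTransformDeriv σ z‖ ≤ 12 * C / ‖z‖ ^ 3 := by
  have hc := measurable_circle_coe
  have hC0 : 0 ≤ C := (norm_nonneg _).trans (hC 1)
  have hz0 : z ≠ 0 := by rw [← norm_pos_iff]; linarith
  have hfar : ∀ ζ : Circle, ‖z‖ / 2 ≤ ‖(ζ : ℂ) - z‖ := fun ζ => by
    have := norm_sub_norm_le z (ζ : ℂ)
    rw [Circle.norm_coe, norm_sub_rev] at this
    linarith
  have hi1 : Integrable (fun ζ : Circle => σ ζ * ζ / (ζ - z) ^ 2) circleMeasure := by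
    refine Integrable.of_bound (C := C / (‖z‖ / 2) ^ 2)
      (by fun_prop : Measurable _).aestronglyMeasurable (Eventually.of_forall fun ζ => ?_)
    rw [norm_div, norm_mul, Circle.norm_coe, mul_one, norm_pow]
    have := hfar ζ
    gcongr
    exact hC ζ
  have hi2 : Integrable (fun ζ : Circle => σ ζ * ζ) circleMeasure := by
    refine Integrable.of_bound (C := C)
      (by fun_prop : Measurable _).aestronglyMeasurable (Eventually.of_forall fun ζ => ?_)
    simpa [Circle.norm_coe] using hC ζ
  have h1 : cauchyTransformDeriv σ z = ∫ ζ : Circle,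
      (σ ζ * ζ / (ζ - z) ^ 2 - (z ^ 2)⁻¹ * (σ ζ * ζ)) ∂circleMeasure := by
    rw [integral_sub hi1 (hi2.const_mul _), integral_const_mul, h0, mul_zero, sub_zero]
    rfl
  rw [h1]
  refine (norm_integral_le_of_norm_le_const (C := 12 * C / ‖z‖ ^ 3)
    (Eventually.of_forall fun ζ => ?_)).trans (by simp)
  have hne : (ζ : ℂ) - z ≠ 0 := by
    rw [← norm_pos_iff]; linarith [hfar ζ]
  have h2 : σ ζ * ζ / (ζ - z) ^ 2 - (z ^ 2)⁻¹ * (σ ζ * ζ) =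
      σ ζ * ζ * (ζ * (2 * z - ζ)) / (z ^ 2 * (ζ - z) ^ 2) := by
    field_simp; ring
  rw [h2, norm_div, norm_mul, norm_mul, norm_mul, norm_mul, norm_pow, norm_pow, Circle.norm_coe]
  have h3 : ‖2 * z - ζ‖ ≤ 3 * ‖z‖ := by
    refine (norm_sub_le _ _).trans ?_
    rw [Circle.norm_coe, norm_mul]
    norm_num
    linarith
  have h4 : ‖z‖ ^ 2 * (‖z‖ / 2) ^ 2 ≤ ‖z‖ ^ 2 * ‖(ζ : ℂ) - z‖ ^ 2 := by
    gcongr; exact hfar ζ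
  calc _ ≤ C * 1 * (1 * (3 * ‖z‖)) / (‖z‖ ^ 2 * (‖z‖ / 2) ^ 2) := by
        gcongr
        exact hC ζ
    _ = _ := by
        have : ‖z‖ ≠ 0 := norm_ne_zero_iff.2 hz0
        field_simp; ring

/-- In polar coordinates the area integral is bounded by
`IsDini.lintegral_kernel_lt_top`. -/
theorem lintegral_ball_enorm_cauchyTransformDeriv_lt_top {σ : Circle → ℂ} (hσ : Measurable σ)
    {C : ℝ} (hC : ∀ ζ, ‖σ ζ‖ ≤ C) (hd : IsDini σ) :
    ∫⁻ z in Metric.ball (0 : ℂ) 2, ‖cauchyTransformDeriv σ z‖ₑ < ⊤ := by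
  have hc := measurable_circle_coe
  set B : ℝ × Circle → ENNReal := fun p =>
    ∫⁻ ξ : Circle, ‖σ (ξ * p.2) - σ p.2‖ₑ * (‖(ξ : ℂ) - p.1‖ₑ ^ 2)⁻¹ ∂circleMeasure with hB
  have hBm : Measurable B := by
    refine Measurable.lintegral_prod_right' (ν := circleMeasure)
      (f := fun q : (ℝ × Circle) × Circle =>
        ‖σ (q.2 * q.1.2) - σ q.1.2‖ₑ * (‖(q.2 : ℂ) - q.1.1‖ₑ ^ 2)⁻¹) ?_
    fun_prop
  have hexp := measurable_circle_exp
  have hBe : Measurable fun p : ℝ × ℝ => B (p.1, Circle.exp p.2) := by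
    exact hBm.comp (measurable_fst.prodMk (hexp.comp measurable_snd))
  set J : ℝ → ENNReal := fun r => ∫⁻ η, B (r, η) ∂circleMeasure with hJ
  have hJle : ∀ r, J r = ∫⁻ ξ : Circle, modulus σ ξ * (‖(ξ : ℂ) - (r : ℝ)‖ₑ ^ 2)⁻¹
      ∂circleMeasure := by
    intro r
    simp only [hJ, hB]
    rw [lintegral_lintegral_swap (by apply Measurable.aemeasurable; fun_prop)]
    refine lintegral_congr fun ξ => ?_
    rw [lintegral_mul_const _ (by fun_prop)]
    rfl
  have hJfin : ∫⁻ r in Set.Ioo (0 : ℝ) 2, J r < ⊤ := by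
    simp only [hJle]
    exact hd.lintegral_kernel_lt_top hσ hC
  have hle : ∀ r : ℝ, 0 ≤ r → r ≠ 1 → ∀ η : Circle,
      ‖cauchyTransformDeriv σ (r * η)‖ₑ ≤ B (r, η) := fun r hr hr1 η =>
    enorm_cauchyTransformDeriv_le hσ hC hr hr1 η
  clear_value B
  have hne : ∀ᵐ p : ℝ × ℝ, p.1 ≠ 1 := by
    have h1 : ∀ᵐ r : ℝ, r ≠ 1 := by simp [ae_iff]
    exact Measure.quasiMeasurePreserving_fst.ae h1
  rw [← lintegral_indicator measurableSet_ball, ← Complex.lintegral_comp_polarCoord_symm]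
  calc _ ≤ ∫⁻ p in polarCoord.target, (Set.Ioo (0 : ℝ) 2).indicator 1 p.1 *
        (2 * B (p.1, Circle.exp p.2)) := by
        refine lintegral_mono_ae ?_
        filter_upwards [ae_restrict_of_ae hne, ae_restrict_mem polarCoord.open_target.measurableSet]
          with p hp1 hp
        rw [polarCoord_target] at hp
        have hr : 0 < p.1 := hp.1
        have hpz : Complex.polarCoord.symm p = p.1 * (Circle.exp p.2 : ℂ) := by
          rw [Complex.polarCoord_symm_apply, Circle.coe_exp, Complex.exp_mul_I]
          simp
        have hnorm : ‖(p.1 : ℂ) * (Circle.exp p.2 : ℂ)‖ = p.1 := by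
          rw [norm_mul, Circle.norm_coe, Complex.norm_real, Real.norm_eq_abs, abs_of_pos hr,
            mul_one]
        rw [hpz]
        by_cases h2 : p.1 < 2
        · rw [Set.indicator_of_mem (by rw [mem_ball_zero_iff, hnorm]; exact h2),
            Set.indicator_of_mem (Set.mem_Ioo.2 ⟨hr, h2⟩), Pi.one_apply, one_mul, smul_eq_mul]
          gcongr
          · rw [← ENNReal.ofReal_ofNat]
            exact ENNReal.ofReal_le_ofReal h2.le
          · exact hle _ hr.le hp1 _
        · rw [Set.indicator_of_notMem (by rw [mem_ball_zero_iff, hnorm]; exact h2), smul_zero]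
          exact zero_le
    _ = ∫⁻ r in Set.Ioi (0 : ℝ), ∫⁻ θ in Set.Ioo (-Real.pi) Real.pi,
          (Set.Ioo (0 : ℝ) 2).indicator 1 r * (2 * B (r, Circle.exp θ)) := by
        rw [polarCoord_target, Measure.volume_eq_prod, ← Measure.prod_restrict, lintegral_prod]
        apply Measurable.aemeasurable
        exact ((measurable_one.indicator measurableSet_Ioo).comp measurable_fst).mul
          (hBe.const_mul _)
    _ ≤ ∫⁻ r, (Set.Ioo (0 : ℝ) 2).indicator 1 r * (2 * (ENNReal.ofReal (2 * Real.pi) * J r)) := by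
        refine (setLIntegral_le_lintegral _ _).trans (lintegral_mono fun r => ?_)
        have hBr : Measurable fun θ : ℝ => B (r, Circle.exp θ) :=
          hBe.comp (measurable_const.prodMk measurable_id)
        rw [lintegral_const_mul _ (hBr.const_mul _), lintegral_const_mul _ hBr]
        gcongr
        simp only [hJ]
        rw [lintegral_circleMeasure, ← mul_assoc, ← ENNReal.ofReal_mul (by positivity),
          mul_inv_cancel₀ Real.two_pi_pos.ne', ENNReal.ofReal_one, one_mul]
        exact lintegral_mono_set Set.Ioo_subset_Ioc_self
    _ = ∫⁻ r in Set.Ioo (0 : ℝ) 2, 2 * (ENNReal.ofReal (2 * Real.pi) * J r) := by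
        rw [← lintegral_indicator measurableSet_Ioo]
        refine lintegral_congr fun r => ?_
        by_cases h : r ∈ Set.Ioo (0 : ℝ) 2 <;> simp [h]
    _ < ⊤ := by
        rw [lintegral_const_mul' _ _ (by simp), lintegral_const_mul' _ _ ENNReal.ofReal_ne_top]
        exact ENNReal.mul_lt_top (by simp) (ENNReal.mul_lt_top ENNReal.ofReal_lt_top hJfin)

theorem lintegral_compl_ball_enorm_cauchyTransformDeriv_lt_top {σ : Circle → ℂ}
    (hσ : Measurable σ) {C : ℝ} (hC : ∀ ζ, ‖σ ζ‖ ≤ C)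
    (h0 : ∫ ζ : Circle, σ ζ * ζ ∂circleMeasure = 0) :
    ∫⁻ z in (Metric.ball (0 : ℂ) 2)ᶜ, ‖cauchyTransformDeriv σ z‖ₑ < ⊤ := by
  have hC0 : 0 ≤ C := (norm_nonneg _).trans (hC 1)
  have hint : Integrable (fun z : ℂ => 96 * C * (1 + ‖z‖) ^ (-(3 : ℝ))) :=
    (integrable_one_add_norm (by rw [Complex.finrank_real_complex]; norm_num)).const_mul _
  calc _ ≤ ∫⁻ z in (Metric.ball (0 : ℂ) 2)ᶜ, ‖96 * C * (1 + ‖z‖) ^ (-(3 : ℝ))‖ₑ := by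
        refine setLIntegral_mono' measurableSet_ball.compl fun z hz => ?_
        have hz2 : 2 ≤ ‖z‖ := by simpa using hz
        rw [← ofReal_norm, ← ofReal_norm]
        apply ENNReal.ofReal_le_ofReal
        refine (norm_cauchyTransformDeriv_le hσ hC h0 hz2).trans ?_
        rw [Real.norm_of_nonneg (by positivity), Real.rpow_neg (by positivity), ← div_eq_mul_inv,
          div_le_div_iff₀ (by positivity) (by positivity)]
        have h1 : (1 + ‖z‖) ^ (3 : ℝ) ≤ (2 * ‖z‖) ^ 3 := by
          rw [show (3 : ℝ) = ((3 : ℕ) : ℝ) by norm_num, Real.rpow_natCast]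
          gcongr
          linarith
        calc 12 * C * (1 + ‖z‖) ^ (3 : ℝ) ≤ 12 * C * (2 * ‖z‖) ^ 3 := by gcongr
          _ = _ := by ring
    _ ≤ ∫⁻ z, ‖96 * C * (1 + ‖z‖) ^ (-(3 : ℝ))‖ₑ := setLIntegral_le_lintegral _ _
    _ < ⊤ := hint.2

theorem memAnalyticSobolev_cauchyTransform {σ : Circle → ℂ} (hσ : Measurable σ) {C : ℝ}
    (hC : ∀ ζ, ‖σ ζ‖ ≤ C) (hd : IsDini σ) (h0 : ∫ ζ : Circle, σ ζ * ζ ∂circleMeasure = 0)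
    {K : Set Circle} (hK : IsCompact K) (hσK : ∀ ζ ∉ K, σ ζ = 0) :
    MemAnalyticSobolev ((fun ζ : Circle => (ζ : ℂ)) '' K)ᶜ (cauchyTransform σ) := by
  have hder := fun z (hz : z ∈ ((fun ζ : Circle => (ζ : ℂ)) '' K)ᶜ) =>
    hasDerivAt_cauchyTransform hσ hC hK hσK hz
  have hcl : IsClosed ((fun ζ : Circle => (ζ : ℂ)) '' K) := (hK.image (by fun_prop)).isClosed
  refine ⟨fun z hz => (hder z hz).differentiableAt.differentiableWithinAt, ?_⟩
  calc _ = ∫⁻ z in ((fun ζ : Circle => (ζ : ℂ)) '' K)ᶜ, ‖cauchyTransformDeriv σ z‖ₑ :=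
        setLIntegral_congr_fun hcl.measurableSet.compl fun z hz => by
          simp only [(hder z hz).deriv]
    _ ≤ ∫⁻ z, ‖cauchyTransformDeriv σ z‖ₑ := setLIntegral_le_lintegral _ _
    _ = _ := (lintegral_add_compl _ (measurableSet_ball (x := (0 : ℂ)) (ε := 2))).symm
    _ < ⊤ := ENNReal.add_lt_top.2
        ⟨lintegral_ball_enorm_cauchyTransformDeriv_lt_top hσ hC hd,
          lintegral_compl_ball_enorm_cauchyTransformDeriv_lt_top hσ hC h0⟩

/-- A density whose Cauchy integral vanishes on the punctured disc has no Fourier coefficients of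
the corresponding sign: with `F k w = ∫ τ ζᵏ / (1 - wζ) dm` one has `F k w = a k + w F (k+1) w`,
so letting `w → 0` the coefficients `a k` vanish one after the other. -/
theorem integral_mul_pow_eq_zero_of_cauchy_eq_zero {τ : Circle → ℂ} (hτ : Measurable τ) {C : ℝ}
    (hC : ∀ ζ, ‖τ ζ‖ ≤ C)
    (h : ∀ w : ℂ, w ≠ 0 → ‖w‖ < 1 → ∫ ζ : Circle, τ ζ / (1 - w * ζ) ∂circleMeasure = 0) (k : ℕ) :
    ∫ ζ : Circle, τ ζ * (ζ : ℂ) ^ k ∂circleMeasure = 0 := by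
  have hc := measurable_circle_coe
  have hC0 : 0 ≤ C := (norm_nonneg _).trans (hC 1)
  have hden : ∀ w : ℂ, ∀ ζ : Circle, 1 - ‖w‖ ≤ ‖1 - w * ζ‖ := fun w ζ => by
    have := norm_sub_norm_le (1 : ℂ) (w * ζ)
    simpa [Circle.norm_coe] using this
  set F : ℕ → ℂ → ℂ := fun k w => ∫ ζ : Circle, τ ζ * (ζ : ℂ) ^ k / (1 - w * ζ) ∂circleMeasure
    with hF
  set a : ℕ → ℂ := fun k => ∫ ζ : Circle, τ ζ * (ζ : ℂ) ^ k ∂circleMeasure with ha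
  have hFle : ∀ k w, ‖w‖ < 1 → ‖F k w‖ ≤ C / (1 - ‖w‖) := fun k w hw => by
    have hpos : 0 < 1 - ‖w‖ := by linarith
    refine (norm_integral_le_of_norm_le_const (C := C / (1 - ‖w‖))
      (Eventually.of_forall fun ζ => ?_)).trans (by simp)
    rw [norm_div, norm_mul, norm_pow, Circle.norm_coe, one_pow, mul_one]
    gcongr
    · exact hC ζ
    · exact hden w ζ
  have hrec : ∀ k w, ‖w‖ < 1 → F k w = a k + w * F (k + 1) w := fun k w hw => by
    have hpos : 0 < 1 - ‖w‖ := by linarith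
    simp only [hF, ha]
    rw [← integral_const_mul, ← integral_add]
    · refine integral_congr_ae (Eventually.of_forall fun ζ => ?_)
      have : 1 - w * (ζ : ℂ) ≠ 0 := by
        rw [← norm_pos_iff]; linarith [hden w ζ]
      field_simp
      ring
    · refine Integrable.of_bound (C := C)
        (by fun_prop : Measurable _).aestronglyMeasurable (Eventually.of_forall fun ζ => ?_)
      rw [norm_mul, norm_pow, Circle.norm_coe, one_pow, mul_one]
      exact hC ζ
    · refine Integrable.of_bound (C := ‖w‖ * (C / (1 - ‖w‖)))
        (by fun_prop : Measurable _).aestronglyMeasurable (Eventually.of_forall fun ζ => ?_)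
      rw [norm_mul, norm_div, norm_mul, norm_pow, Circle.norm_coe, one_pow, mul_one]
      gcongr
      · exact hC ζ
      · exact hden w ζ
  have hzero : ∀ k, (∀ w : ℂ, w ≠ 0 → ‖w‖ < 1 → F k w = 0) → a k = 0 := fun k hk => by
    have hle : ∀ᶠ x : ℝ in 𝓝[>] 0, ‖a k‖ ≤ x * (C / (1 - x)) := by
      filter_upwards [Ioo_mem_nhdsGT (one_pos : (0 : ℝ) < 1)] with x hx
      have hxn : ‖(x : ℂ)‖ = x := by rw [Complex.norm_real, Real.norm_of_nonneg hx.1.le]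
      have h1 : ‖(x : ℂ)‖ < 1 := by rw [hxn]; exact hx.2
      have h2 := hrec k x h1
      rw [hk x (by exact_mod_cast hx.1.ne') h1] at h2
      rw [eq_neg_of_add_eq_zero_left h2.symm, norm_neg, norm_mul, hxn]
      have h3 := hFle (k + 1) x h1
      rw [hxn] at h3
      have := hx.1.le
      gcongr
    have hlim : Tendsto (fun x : ℝ => x * (C / (1 - x))) (𝓝[>] 0) (𝓝 0) := by
      have : ContinuousAt (fun x : ℝ => x * (C / (1 - x))) 0 := by
        refine continuousAt_id.mul (continuousAt_const.div (by fun_prop) (by simp))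
      have h2 := this.tendsto.mono_left (nhdsWithin_le_nhds (s := Set.Ioi 0))
      simpa using h2
    exact norm_le_zero_iff.1 (ge_of_tendsto hlim hle)
  have hall : ∀ k, ∀ w : ℂ, w ≠ 0 → ‖w‖ < 1 → F k w = 0 := by
    intro k
    induction k with
    | zero => intro w h1 h2; simpa [hF] using h w h1 h2
    | succ k ih =>
      intro w h1 h2
      have h3 := hrec k w h2
      rw [ih w h1 h2, hzero k ih, zero_add] at h3
      exact (mul_eq_zero.1 h3.symm).resolve_left h1
  exact hzero k (hall k)

/-- The transform vanishes at infinity, so a constant transform is zero; then the expansions inside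
and outside the circle kill the Fourier coefficients of `σ` of both signs. -/
theorem ae_eq_zero_of_cauchyTransform_const {σ : Circle → ℂ} (hσ : Measurable σ) {C : ℝ}
    (hC : ∀ ζ, ‖σ ζ‖ ≤ C) {c : ℂ} (h : ∀ z : ℂ, ‖z‖ ≠ 1 → cauchyTransform σ z = c) :
    σ =ᵐ[circleMeasure] 0 := by
  have hc := measurable_circle_coe
  have hC0 : 0 ≤ C := (norm_nonneg _).trans (hC 1)
  have hc0 : c = 0 := by
    have hle : ∀ᶠ x : ℝ in atTop, ‖c‖ ≤ C / (x - 1) := by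
      filter_upwards [eventually_gt_atTop 1] with x hx
      have hxn : ‖(x : ℂ)‖ = x := by rw [Complex.norm_real, Real.norm_of_nonneg (by linarith)]
      rw [← h x (by rw [hxn]; exact hx.ne')]
      refine (norm_integral_le_of_norm_le_const (C := C / (x - 1))
        (Eventually.of_forall fun ζ => ?_)).trans (by simp)
      rw [norm_div, norm_mul, Circle.norm_coe, mul_one]
      have h1 := norm_sub_norm_le (x : ℂ) ζ
      rw [Circle.norm_coe, norm_sub_rev, hxn] at h1
      have : 0 < x - 1 := by linarith
      gcongr
      exact hC ζ
    have hlim : Tendsto (fun x : ℝ => C / (x - 1)) atTop (𝓝 0) :=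
      tendsto_const_nhds.div_atTop (tendsto_atTop_add_const_right _ _ tendsto_id)
    exact norm_le_zero_iff.1 (ge_of_tendsto hlim hle)
  subst hc0
  have hden : ∀ w : ℂ, ‖w‖ < 1 → ∀ ζ : Circle, 1 - w * ζ ≠ 0 := fun w hw ζ h0 => by
    have h1 : ‖w * (ζ : ℂ)‖ = 1 := by rw [← sub_eq_zero.1 h0, norm_one]
    rw [norm_mul, Circle.norm_coe, mul_one] at h1
    linarith
  have hout := integral_mul_pow_eq_zero_of_cauchy_eq_zero (τ := fun ζ => σ ζ * ζ) (C := C)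
    (by fun_prop) (fun ζ => by simpa [Circle.norm_coe] using hC ζ) (fun w hw0 hw => by
      have h1 := h w⁻¹ (by
        rw [norm_inv]
        intro h2
        rw [inv_eq_one] at h2
        linarith)
      have h2 : ∫ ζ : Circle, σ ζ * ζ / (1 - w * ζ) ∂circleMeasure =
          ∫ ζ : Circle, -w⁻¹ * (σ ζ * ζ / (ζ - w⁻¹)) ∂circleMeasure := by
        refine integral_congr_ae (Eventually.of_forall fun ζ => ?_)
        have h3 := hden w hw ζ
        have h4 : (ζ : ℂ) - w⁻¹ = -w⁻¹ * (1 - w * ζ) := by field_simp; ring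
        dsimp only
        rw [h4]
        field_simp
      rw [h2, integral_const_mul]
      change -w⁻¹ * cauchyTransform σ w⁻¹ = 0
      rw [h1, mul_zero])
  have hin := integral_mul_pow_eq_zero_of_cauchy_eq_zero (τ := fun ζ => σ ζ⁻¹) (C := C)
    (by fun_prop) (fun ζ => hC _) (fun w hw0 hw => by
      have h1 := h w hw.ne
      rw [cauchyTransform, ← integral_inv_eq_self] at h1
      rw [← h1]
      refine integral_congr_ae (Eventually.of_forall fun ζ => ?_)
      have h3 := hden w hw ζ
      have h4 := Circle.coe_ne_zero ζ
      have h5 : (ζ : ℂ)⁻¹ - w = (ζ : ℂ)⁻¹ * (1 - w * ζ) := by field_simp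
      dsimp only
      rw [Circle.coe_inv, h5]
      field_simp)
  refine ae_eq_zero_of_forall_integral_zpow_eq_zero
    (memLp_top_of_bound hσ.aestronglyMeasurable C (Eventually.of_forall hC)) fun n => ?_
  rcases lt_or_ge 0 n with hn | hn
  · obtain ⟨k, rfl⟩ : ∃ k : ℕ, n = k + 1 := ⟨(n - 1).toNat, by omega⟩
    rw [← hout k]
    refine integral_congr_ae (Eventually.of_forall fun ζ => ?_)
    dsimp only
    rw [zpow_add_one₀ (Circle.coe_ne_zero ζ), zpow_natCast]
    ring
  · obtain ⟨k, rfl⟩ : ∃ k : ℕ, n = -(k : ℤ) := ⟨(-n).toNat, by omega⟩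
    rw [← hin k, ← integral_inv_eq_self]
    refine integral_congr_ae (Eventually.of_forall fun ζ => ?_)
    simp

theorem not_isRemovable_of_isDini {σ : Circle → ℂ} (hσ : Measurable σ) {C : ℝ}
    (hC : ∀ ζ, ‖σ ζ‖ ≤ C) (hd : IsDini σ) (h0 : ∫ ζ : Circle, σ ζ * ζ ∂circleMeasure = 0)
    (hne : ¬ σ =ᵐ[circleMeasure] 0)
    {K : Set Circle} (hK : IsCompact K) (hσK : ∀ ζ ∉ K, σ ζ = 0) :
    ¬ IsRemovable ((fun ζ : Circle => (ζ : ℂ)) '' K) := by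
  intro hrem
  obtain ⟨c, hc⟩ := hrem _ (memAnalyticSobolev_cauchyTransform hσ hC hd h0 hK hσK)
  refine hne (ae_eq_zero_of_cauchyTransform_const hσ hC (c := c) fun z hz => hc z ?_)
  rintro ⟨ζ, -, rfl⟩
  exact hz (Circle.norm_coe ζ)

/-- The mean-zero condition of `not_isRemovable_of_isDini` is arranged by multiplying a given
density by `1 - c ζ̄`, where `c` is its centre of mass. -/
theorem not_isRemovable_of_isDini_of_integral_ne_zero {φ : Circle → ℂ} (hφ : Measurable φ) {C : ℝ}
    (hC : ∀ ζ, ‖φ ζ‖ ≤ C) (hd : IsDini φ) (h0 : ∫ ζ, φ ζ ∂circleMeasure ≠ 0)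
    {K : Set Circle} (hK : IsCompact K) (hφK : ∀ ζ ∉ K, φ ζ = 0) :
    ¬ IsRemovable ((fun ζ : Circle => (ζ : ℂ)) '' K) := by
  have hm := measurable_circle_coe
  set c : ℂ := (∫ ζ : Circle, φ ζ * ζ ∂circleMeasure) / ∫ ζ, φ ζ ∂circleMeasure with hc
  have hB : ∀ ζ : Circle, ‖1 - c * (ζ : ℂ)⁻¹‖ ≤ 1 + ‖c‖ := fun ζ => by
    refine (norm_sub_le _ _).trans ?_
    simp [Circle.norm_coe]
  have hi1 : Integrable (fun ζ : Circle => φ ζ * ζ) circleMeasure :=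
    Integrable.of_bound (C := C) (by fun_prop : Measurable _).aestronglyMeasurable
      (Eventually.of_forall fun ζ => by simpa [Circle.norm_coe] using hC ζ)
  have hi2 : Integrable φ circleMeasure :=
    Integrable.of_bound (C := C) hφ.aestronglyMeasurable (Eventually.of_forall hC)
  refine not_isRemovable_of_isDini (σ := fun ζ => φ ζ * (1 - c * (ζ : ℂ)⁻¹)) (C := C * (1 + ‖c‖))
    (by fun_prop) (fun ζ => ?_) (hd.mul hφ hC hB (L := ‖c‖) fun t ht ζ => ?_) ?_ ?_ hK
    (fun ζ hζ => by simp [hφK ζ hζ])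
  · rw [norm_mul]
    have := (norm_nonneg _).trans (hC ζ)
    gcongr
    · exact hC ζ
    · exact hB ζ
  · have h1 : 1 - c * ((Circle.exp t * ζ : Circle) : ℂ)⁻¹ - (1 - c * (ζ : ℂ)⁻¹) =
        c * (Circle.exp t * ζ : Circle)⁻¹ * ((Circle.exp t : ℂ) - 1) := by
      have h2 := Circle.coe_ne_zero ζ
      have h3 := Circle.coe_ne_zero (Circle.exp t)
      simp only [Circle.coe_inv, Circle.coe_mul]
      field_simp
      ring
    rw [h1, norm_mul, norm_mul, Circle.norm_coe, mul_one]
    have := norm_exp_sub_one_le t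
    rw [abs_of_pos ht] at this
    gcongr
  · have h1 : ∀ ζ : Circle, φ ζ * (1 - c * (ζ : ℂ)⁻¹) * ζ = φ ζ * ζ - c * φ ζ := fun ζ => by
      have := Circle.coe_ne_zero ζ
      field_simp
    simp only [h1]
    rw [integral_sub hi1 (hi2.const_mul _), integral_const_mul, hc, div_mul_cancel₀ _ h0, sub_self]
  · intro hae
    refine h0 (integral_eq_zero_of_ae ?_)
    have hpt : ∀ᵐ ζ : Circle ∂circleMeasure, (ζ : ℂ) ≠ c := by
      have hsub : Set.Subsingleton {ζ : Circle | (ζ : ℂ) = c} := fun x hx y hy =>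
        Circle.ext (hx.trans hy.symm)
      rw [ae_iff]
      simpa using hsub.measure_zero circleMeasure
    filter_upwards [hae, hpt] with ζ h1 h2
    refine (mul_eq_zero.1 h1).resolve_right fun h3 => h2 ?_
    have := Circle.coe_ne_zero ζ
    rw [sub_eq_zero, eq_comm, mul_inv_eq_one₀ this] at h3
    exact h3.symm

/-! ### Pairing with Bloch functions -/

/-- The kernel `(1 - ρξ)⁻² - 1 = ∑_{k ≥ 1} (k + 1) ρᵏ ξᵏ`. -/
noncomputable def blochKernel (ρ : ℝ) (ξ : Circle) : ℂ := ((1 - ρ * (ξ : ℂ)) ^ 2)⁻¹ - 1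

/-- The average of rotations of `φ` against `blochKernel ρ`. -/
noncomputable def kernelAverage (φ : Circle → ℂ) (ρ : ℝ) (ζ : Circle) : ℂ :=
  ∫ ξ : Circle, φ (ξ * ζ) * blochKernel ρ ξ ∂circleMeasure

theorem norm_one_sub_mul_eq (ρ : ℝ) (ξ : Circle) : ‖1 - ρ * (ξ : ℂ)‖ = ‖(ξ : ℂ) - ρ‖ := by
  have h : starRingEnd ℂ (1 - ρ * (ξ : ℂ)) = (ξ : ℂ)⁻¹ * (ξ - ρ) := by
    have := Circle.coe_ne_zero ξ
    rw [map_sub, map_one, map_mul, Complex.conj_ofReal, ← Circle.coe_inv_eq_conj, Circle.coe_inv]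
    field_simp
  rw [← Complex.norm_conj, h, norm_mul, norm_inv, Circle.norm_coe, inv_one, one_mul]

theorem one_sub_mul_ne_zero {ρ : ℝ} (h0 : 0 ≤ ρ) (h1 : ρ < 1) (ξ : Circle) :
    1 - ρ * (ξ : ℂ) ≠ 0 := by
  rw [← norm_pos_iff, norm_one_sub_mul_eq, norm_pos_iff]
  exact coe_sub_ofReal_ne_zero h0 h1.ne ξ

theorem continuous_blochKernel {ρ : ℝ} (h0 : 0 ≤ ρ) (h1 : ρ < 1) : Continuous (blochKernel ρ) := by
  unfold blochKernel
  refine Continuous.sub (Continuous.inv₀ (by fun_prop) fun ξ => ?_) continuous_const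
  exact pow_ne_zero _ (one_sub_mul_ne_zero h0 h1 ξ)

theorem enorm_blochKernel_le {ρ : ℝ} (h0 : 0 ≤ ρ) (h1 : ρ < 1) (ξ : Circle) :
    ‖blochKernel ρ ξ‖ₑ ≤ 3 * (‖(ξ : ℂ) - ρ‖ₑ ^ 2)⁻¹ := by
  have hne := one_sub_mul_ne_zero h0 h1 ξ
  have hpos : 0 < ‖(ξ : ℂ) - ρ‖ := by rw [← norm_one_sub_mul_eq]; exact norm_pos_iff.2 hne
  have h : blochKernel ρ ξ = (ρ * ξ * (2 - ρ * ξ)) / (1 - ρ * (ξ : ℂ)) ^ 2 := by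
    rw [blochKernel]; field_simp; ring
  have hn : ‖(ρ : ℂ) * ξ‖ ≤ 1 := by
    rw [norm_mul, Circle.norm_coe, mul_one, Complex.norm_real, Real.norm_of_nonneg h0]
    exact h1.le
  rw [← ofReal_norm, ← ofReal_norm, ← ENNReal.ofReal_pow (norm_nonneg _),
    ← ENNReal.ofReal_inv_of_pos (by positivity), ← ENNReal.ofReal_ofNat,
    ← ENNReal.ofReal_mul (by norm_num)]
  apply ENNReal.ofReal_le_ofReal
  rw [h, norm_div, norm_pow, norm_one_sub_mul_eq, norm_mul, ← div_eq_mul_inv]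
  gcongr
  have h3 : ‖(2 : ℂ) - ρ * ξ‖ ≤ 3 := by
    refine (norm_sub_le _ _).trans ?_
    norm_num at hn ⊢
    linarith
  nlinarith [norm_nonneg ((ρ : ℂ) * ξ), norm_nonneg ((2 : ℂ) - ρ * ξ)]

theorem integral_zpow_neg_mul_blochKernel {ρ : ℝ} (h0 : 0 ≤ ρ) (h1 : ρ < 1) (k : ℕ) :
    ∫ ξ : Circle, (ξ : ℂ) ^ (-(k : ℤ)) * blochKernel ρ ξ ∂circleMeasure =
      if k = 0 then 0 else ((k : ℂ) + 1) * ρ ^ k := by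
  have hz : Continuous fun ξ : Circle => (ξ : ℂ) ^ (-(k : ℤ)) := by
    have : Continuous fun ζ : Circle => ((ζ ^ (-(k : ℤ)) : Circle) : ℂ) :=
      (by fun_prop : Continuous fun ζ : Circle => (ζ : ℂ)).comp (continuous_zpow _)
    simpa using this
  have hk : Continuous fun ξ : Circle => ((1 - ρ * (ξ : ℂ)) ^ 2)⁻¹ :=
    Continuous.inv₀ (by fun_prop) fun ξ => pow_ne_zero _ (one_sub_mul_ne_zero h0 h1 ξ)
  have hi : Integrable (fun ξ : Circle => (ξ : ℂ) ^ (-(k : ℤ)) * ((1 - ρ * (ξ : ℂ)) ^ 2)⁻¹)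
      circleMeasure := integrable_of_continuous_circle (hz.mul hk)
  simp only [blochKernel, mul_sub, mul_one]
  rw [integral_sub hi (integrable_of_continuous_circle hz), integral_circle_zpow,
    integral_zpow_neg_mul_kernel (by
      rw [Complex.norm_real, Real.norm_of_nonneg h0]; exact h1)]
  by_cases h : k = 0 <;> simp [h]

theorem integrable_mul_blochKernel {φ : Circle → ℂ} (hφ : Measurable φ) {C : ℝ}
    (hC : ∀ ζ, ‖φ ζ‖ ≤ C) {ρ : ℝ} (h0 : 0 ≤ ρ) (h1 : ρ < 1) (ζ : Circle) :
    Integrable (fun ξ => φ (ξ * ζ) * blochKernel ρ ξ) circleMeasure :=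
  (integrable_of_continuous_circle (continuous_blochKernel h0 h1)).bdd_mul (c := C)
    (by fun_prop : Measurable _).aestronglyMeasurable (Eventually.of_forall fun ξ => hC _)

theorem stronglyMeasurable_kernelAverage {φ : Circle → ℂ} (hφ : Measurable φ) {ρ : ℝ}
    (h0 : 0 ≤ ρ) (h1 : ρ < 1) : StronglyMeasurable (kernelAverage φ ρ) := by
  have := (continuous_blochKernel h0 h1).measurable
  exact StronglyMeasurable.integral_prod_right' (ν := circleMeasure)
    (f := fun p : Circle × Circle => φ (p.2 * p.1) * blochKernel ρ p.2)
    (Measurable.stronglyMeasurable (by fun_prop))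

theorem integrable_kernelAverage {φ : Circle → ℂ} (hφ : Measurable φ) {C : ℝ}
    (hC : ∀ ζ, ‖φ ζ‖ ≤ C) {ρ : ℝ} (h0 : 0 ≤ ρ) (h1 : ρ < 1) :
    Integrable (kernelAverage φ ρ) circleMeasure := by
  obtain ⟨D, hD⟩ :=
    isCompact_univ.exists_bound_of_continuousOn (continuous_blochKernel h0 h1).continuousOn
  have hC0 : 0 ≤ C := (norm_nonneg _).trans (hC 1)
  refine Integrable.of_bound (C := C * D)
    (stronglyMeasurable_kernelAverage hφ h0 h1).aestronglyMeasurable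
    (Eventually.of_forall fun ζ => ?_)
  refine (norm_integral_le_of_norm_le_const (C := C * D)
    (Eventually.of_forall fun ξ => ?_)).trans (by simp)
  rw [norm_mul]
  gcongr
  · exact hC _
  · exact hD _ (Set.mem_univ _)

/-- `blochKernel ρ` has mean zero, so only the increments of `φ` enter. -/
theorem lintegral_enorm_kernelAverage_le {φ : Circle → ℂ} (hφ : Measurable φ) {C : ℝ}
    (hC : ∀ ζ, ‖φ ζ‖ ≤ C) {ρ : ℝ} (h0 : 0 ≤ ρ) (h1 : ρ < 1) :
    ∫⁻ ζ, ‖kernelAverage φ ρ ζ‖ₑ ∂circleMeasure ≤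
      3 * ∫⁻ ξ : Circle, modulus φ ξ * (‖(ξ : ℂ) - ρ‖ₑ ^ 2)⁻¹ ∂circleMeasure := by
  have hc := measurable_circle_coe
  have hmean : ∫ ξ, blochKernel ρ ξ ∂circleMeasure = 0 := by
    simpa using integral_zpow_neg_mul_blochKernel h0 h1 0
  have hki := integrable_of_continuous_circle (continuous_blochKernel h0 h1)
  have hpt : ∀ ζ, ‖kernelAverage φ ρ ζ‖ₑ ≤ ∫⁻ ξ : Circle, ‖φ (ξ * ζ) - φ ζ‖ₑ *
      (3 * (‖(ξ : ℂ) - ρ‖ₑ ^ 2)⁻¹) ∂circleMeasure := fun ζ => by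
    have h2 : kernelAverage φ ρ ζ =
        ∫ ξ : Circle, (φ (ξ * ζ) - φ ζ) * blochKernel ρ ξ ∂circleMeasure := by
      simp only [sub_mul]
      rw [integral_sub (integrable_mul_blochKernel hφ hC h0 h1 ζ) (hki.const_mul _),
        integral_const_mul, hmean, mul_zero, sub_zero, kernelAverage]
    rw [h2]
    refine (enorm_integral_le_lintegral_enorm _).trans (lintegral_mono fun ξ => ?_)
    rw [enorm_mul]
    gcongr
    exact enorm_blochKernel_le h0 h1 ξ
  refine (lintegral_mono hpt).trans ?_
  rw [lintegral_lintegral_swap (by apply Measurable.aemeasurable; fun_prop),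
    ← lintegral_const_mul' _ _ (by simp)]
  refine lintegral_mono fun ξ => ?_
  rw [lintegral_mul_const _ (by fun_prop)]
  change modulus φ ξ * _ ≤ _
  apply le_of_eq; ring

theorem integral_pow_mul_kernelAverage {φ : Circle → ℂ} (hφ : Measurable φ) {C : ℝ}
    (hC : ∀ ζ, ‖φ ζ‖ ≤ C) {ρ : ℝ} (h0 : 0 ≤ ρ) (h1 : ρ < 1) {k : ℕ} (hk : k ≠ 0) :
    ∫ ζ : Circle, (ζ : ℂ) ^ k * kernelAverage φ ρ ζ ∂circleMeasure =
      ((k : ℂ) + 1) * ρ ^ k * ∫ ζ : Circle, (ζ : ℂ) ^ k * φ ζ ∂circleMeasure := by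
  have hc := measurable_circle_coe
  have hkc := continuous_blochKernel h0 h1
  have hkm := hkc.measurable
  obtain ⟨D, hD⟩ := isCompact_univ.exists_bound_of_continuousOn hkc.continuousOn
  have hC0 : 0 ≤ C := (norm_nonneg _).trans (hC 1)
  have hint : Integrable (Function.uncurry fun (ζ ξ : Circle) =>
      (ζ : ℂ) ^ k * (φ (ξ * ζ) * blochKernel ρ ξ)) (circleMeasure.prod circleMeasure) := by
    refine Integrable.of_bound (C := C * D) (Measurable.aestronglyMeasurable (by fun_prop))
      (Eventually.of_forall fun p => ?_)
    rw [Function.uncurry, norm_mul, norm_pow, Circle.norm_coe, one_pow, one_mul, norm_mul]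
    gcongr
    · exact hC _
    · exact hD _ (Set.mem_univ _)
  simp only [kernelAverage, ← integral_const_mul]
  rw [integral_integral_swap hint, integral_const_mul]
  have h2 : ∀ ξ : Circle, ∫ ζ : Circle, (ζ : ℂ) ^ k * (φ (ξ * ζ) * blochKernel ρ ξ) ∂circleMeasure
      = ((ξ : ℂ) ^ (-(k : ℤ)) * blochKernel ρ ξ) *
        ∫ ζ : Circle, (ζ : ℂ) ^ k * φ ζ ∂circleMeasure := fun ξ => by
    rw [← integral_mul_left_eq_self (fun ζ : Circle => (ζ : ℂ) ^ k * φ ζ) ξ, ← integral_const_mul]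
    refine integral_congr_ae (Eventually.of_forall fun ζ => ?_)
    have := Circle.coe_ne_zero ξ
    dsimp only
    rw [Circle.coe_mul, mul_pow, zpow_neg, zpow_natCast]
    field_simp
  simp only [h2]
  rw [integral_mul_const, integral_zpow_neg_mul_blochKernel h0 h1, if_neg hk]

/-- The weights recombining the coefficients `k` of `Q'` and `k + 1` of `blochKernel`. -/
theorem integral_weight {k : ℕ} (hk : k ≠ 0) :
    ∫ ρ in (0 : ℝ)..1, 2 * (1 - ρ ^ 2) * (k * (k + 1) * ρ ^ (2 * k - 1)) = 1 := by
  obtain ⟨j, rfl⟩ := Nat.exists_eq_succ_of_ne_zero hk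
  have h : ∀ ρ : ℝ, 2 * (1 - ρ ^ 2) * (((j.succ : ℕ) : ℝ) * (((j.succ : ℕ) : ℝ) + 1) *
      ρ ^ (2 * j.succ - 1)) = 2 * ((j : ℝ) + 1) * (j + 2) * ρ ^ (2 * j + 1) -
        2 * ((j : ℝ) + 1) * (j + 2) * ρ ^ (2 * j + 3) := fun ρ => by
    rw [show 2 * j.succ - 1 = 2 * j + 1 by omega]
    push_cast
    ring
  simp only [h]
  rw [intervalIntegral.integral_sub
    (Continuous.intervalIntegrable (by fun_prop) _ _)
    (Continuous.intervalIntegrable (by fun_prop) _ _),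
    intervalIntegral.integral_const_mul, intervalIntegral.integral_const_mul, integral_pow,
    integral_pow]
  have h1 : (j : ℝ) + 1 ≠ 0 := by positivity
  have h2 : (j : ℝ) + 2 ≠ 0 := by positivity
  push_cast
  simp only [one_pow, ne_eq, Nat.add_eq_zero_iff, OfNat.ofNat_ne_zero, not_false_eq_true, zero_pow,
    one_ne_zero, and_false, sub_zero]
  have h3 : (2 * (j : ℝ) + 1 + 1) ≠ 0 := by positivity
  have h4 : (2 * (j : ℝ) + 3 + 1) ≠ 0 := by positivity
  field_simp
  ring

/-- The Littlewood–Paley type identity expressing `∫ Q φ dm` through the derivative of `Q`. -/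
theorem integral_eval_mul_eq {φ : Circle → ℂ} (hφ : Measurable φ) {C : ℝ}
    (hC : ∀ ζ, ‖φ ζ‖ ≤ C) (Q : Polynomial ℂ) :
    ∫ ζ : Circle, Q.eval (ζ : ℂ) * φ ζ ∂circleMeasure =
      Q.eval 0 * ∫ ζ, φ ζ ∂circleMeasure +
      ∫ ρ in Set.Ioo (0 : ℝ) 1, (2 * (1 - ρ ^ 2) : ℝ) *
        ∫ ζ : Circle, ζ * Q.derivative.eval (ρ * ζ : ℂ) * kernelAverage φ ρ ζ ∂circleMeasure := by
  have hc := measurable_circle_coe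
  set c : ℕ → ℂ := fun k => Q.coeff k * ∫ ζ : Circle, (ζ : ℂ) ^ k * φ ζ ∂circleMeasure with hcdef
  have hQ : ∫ ζ : Circle, Q.eval (ζ : ℂ) * φ ζ ∂circleMeasure =
      ∑ k ∈ Finset.range (Q.natDegree + 1), c k := by
    simp only [Polynomial.eval_eq_sum_range, Finset.sum_mul, mul_assoc]
    rw [integral_finsetSum]
    · simp only [integral_const_mul, hcdef]
    · intro k _
      refine Integrable.const_mul (Integrable.of_bound (C := C)
        (Measurable.aestronglyMeasurable (by fun_prop)) (Eventually.of_forall fun ζ => ?_)) _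
      rw [norm_mul, norm_pow, Circle.norm_coe, one_pow, one_mul]
      exact hC ζ
  have hD : ∀ ρ ∈ Set.Ioo (0 : ℝ) 1, ((2 * (1 - ρ ^ 2) : ℝ) : ℂ) *
      ∫ ζ : Circle, ζ * Q.derivative.eval (ρ * ζ : ℂ) * kernelAverage φ ρ ζ ∂circleMeasure =
      ∑ k ∈ Finset.range (Q.natDegree + 1),
        ((2 * (1 - ρ ^ 2) * (k * (k + 1) * ρ ^ (2 * k - 1)) : ℝ) : ℂ) * c k := fun ρ hρ => by
    have h1 : ∀ ζ : Circle, ζ * Q.derivative.eval (ρ * ζ : ℂ) * kernelAverage φ ρ ζ =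
        ∑ k ∈ Finset.range (Q.natDegree + 1),
          Q.coeff k * k * ρ ^ (k - 1) * ((ζ : ℂ) ^ k * kernelAverage φ ρ ζ) := fun ζ => by
      rw [Polynomial.derivative_eval, Polynomial.sum_over_range _ (by simp), Finset.mul_sum,
        Finset.sum_mul]
      refine Finset.sum_congr rfl fun k _ => ?_
      rcases k with _ | k
      · simp
      · simp only [Nat.add_sub_cancel]
        ring
    simp only [h1]
    rw [integral_finsetSum, Finset.mul_sum]
    · refine Finset.sum_congr rfl fun k _ => ?_
      rcases k with _ | k
      · simp
      · rw [integral_const_mul, integral_pow_mul_kernelAverage hφ hC hρ.1.le hρ.2 (by omega)]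
        rw [show 2 * (k + 1) - 1 = k + (k + 1) by omega]
        simp only [hcdef, Nat.add_sub_cancel]
        push_cast
        ring
    · intro k _
      refine Integrable.const_mul ((integrable_kernelAverage hφ hC hρ.1.le hρ.2).bdd_mul (c := 1)
        (Measurable.aestronglyMeasurable (by fun_prop)) (Eventually.of_forall fun ζ => ?_)) _
      rw [norm_pow, Circle.norm_coe, one_pow]
  have hw : ∀ k : ℕ, Integrable
      (fun ρ : ℝ => ((2 * (1 - ρ ^ 2) * (k * (k + 1) * ρ ^ (2 * k - 1)) : ℝ) : ℂ))
      (volume.restrict (Set.Ioo 0 1)) := fun k =>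
    ((Continuous.integrableOn_Icc (by fun_prop)).mono_set Set.Ioo_subset_Icc_self)
  rw [hQ, setIntegral_congr_fun measurableSet_Ioo hD,
    integral_finsetSum _ fun k _ => (hw k).mul_const _, Finset.sum_range_succ',
    Finset.sum_range_succ', add_comm]
  congr 1
  · simp [hcdef, Polynomial.coeff_zero_eq_eval_zero]
  · rw [← add_zero (∑ k ∈ Finset.range Q.natDegree, c (k + 1))]
    congr 1
    · refine Finset.sum_congr rfl fun k _ => ?_
      rw [integral_mul_const, integral_complex_ofReal, ← integral_Ioc_eq_integral_Ioo,
        ← intervalIntegral.integral_of_le zero_le_one, integral_weight (by omega)]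
      simp
    · simp

/-- A Dini function defines, through its `L²` pairing with polynomials, a functional bounded in the
Bloch norm: `(1 - ρ) |Q'| ≤ ‖Q‖` absorbs the weight `1 - ρ²`. -/
theorem enorm_integral_eval_mul_le {φ : Circle → ℂ} (hφ : Measurable φ) {C : ℝ}
    (hC : ∀ ζ, ‖φ ζ‖ ≤ C) (Q : Polynomial ℂ) :
    ‖∫ ζ : Circle, Q.eval (ζ : ℂ) * φ ζ ∂circleMeasure‖ₑ ≤
      blochNorm (fun z => Q.eval z) * (ENNReal.ofReal C + 12 * ∫⁻ r in Set.Ioo (0 : ℝ) 2,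
        ∫⁻ ξ : Circle, modulus φ ξ * (‖(ξ : ℂ) - (r : ℝ)‖ₑ ^ 2)⁻¹ ∂circleMeasure) := by
  set S : ENNReal := ⨆ z ∈ Metric.ball (0 : ℂ) 1,
    ENNReal.ofReal ((1 - ‖z‖) * ‖deriv (fun z => Q.eval z) z‖) with hS
  set J : ℝ → ENNReal := fun r =>
    ∫⁻ ξ : Circle, modulus φ ξ * (‖(ξ : ℂ) - (r : ℝ)‖ₑ ^ 2)⁻¹ ∂circleMeasure with hJ
  have hmean : ‖∫ ζ, φ ζ ∂circleMeasure‖ₑ ≤ ENNReal.ofReal C := by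
    rw [← ofReal_norm]
    exact ENNReal.ofReal_le_ofReal
      ((norm_integral_le_of_norm_le_const (Eventually.of_forall hC)).trans (by simp))
  have hpt : ∀ ρ ∈ Set.Ioo (0 : ℝ) 1, ‖((2 * (1 - ρ ^ 2) : ℝ) : ℂ) *
      ∫ ζ : Circle, ζ * Q.derivative.eval (ρ * ζ : ℂ) * kernelAverage φ ρ ζ ∂circleMeasure‖ₑ ≤
        12 * S * J ρ := fun ρ hρ => by
    have hq : ∀ ζ : Circle, ENNReal.ofReal (2 * (1 - ρ ^ 2)) *
        ‖(ζ : ℂ) * Q.derivative.eval (ρ * ζ : ℂ)‖ₑ ≤ 4 * S := fun ζ => by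
      have hn : ‖(ρ : ℂ) * ζ‖ = ρ := by
        rw [norm_mul, Circle.norm_coe, mul_one, Complex.norm_real, Real.norm_of_nonneg hρ.1.le]
      have h1 : ENNReal.ofReal ((1 - ρ) * ‖Q.derivative.eval (ρ * ζ : ℂ)‖) ≤ S := by
        have h2 := le_iSup₂ (f := fun (z : ℂ) (_ : z ∈ Metric.ball (0 : ℂ) 1) =>
          ENNReal.ofReal ((1 - ‖z‖) * ‖deriv (fun z => Q.eval z) z‖)) (ρ * ζ)
          (by rw [mem_ball_zero_iff, hn]; exact hρ.2)
        rw [Polynomial.deriv, hn] at h2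
        exact h2
      have h3 : 0 < 1 - ρ := by linarith [hρ.2]
      calc _ ≤ 4 * ENNReal.ofReal ((1 - ρ) * ‖Q.derivative.eval (ρ * ζ : ℂ)‖) := by
            have h4 : (0 : ℝ) ≤ 2 * (1 - ρ ^ 2) := by nlinarith [hρ.1, hρ.2]
            rw [← ofReal_norm, ← ENNReal.ofReal_mul h4,
              ← ENNReal.ofReal_ofNat (n := 4), ← ENNReal.ofReal_mul (by norm_num), norm_mul,
              Circle.norm_coe, one_mul, ← mul_assoc]
            apply ENNReal.ofReal_le_ofReal
            refine mul_le_mul_of_nonneg_right ?_ (norm_nonneg _)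
            nlinarith [hρ.1, hρ.2]
        _ ≤ _ := by gcongr
    rw [enorm_mul]
    have h5 : ‖((2 * (1 - ρ ^ 2) : ℝ) : ℂ)‖ₑ = ENNReal.ofReal (2 * (1 - ρ ^ 2)) := by
      rw [← ofReal_norm, Complex.norm_real, Real.norm_of_nonneg]
      nlinarith [hρ.1, hρ.2]
    rw [h5]
    calc _ ≤ ENNReal.ofReal (2 * (1 - ρ ^ 2)) * ∫⁻ ζ : Circle,
          ‖(ζ : ℂ) * Q.derivative.eval (ρ * ζ : ℂ) * kernelAverage φ ρ ζ‖ₑ ∂circleMeasure := by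
          gcongr; exact enorm_integral_le_lintegral_enorm _
      _ ≤ ∫⁻ ζ, 4 * S * ‖kernelAverage φ ρ ζ‖ₑ ∂circleMeasure := by
          rw [← lintegral_const_mul' _ _ ENNReal.ofReal_ne_top]
          refine lintegral_mono fun ζ => ?_
          rw [enorm_mul _ (kernelAverage φ ρ ζ), ← mul_assoc]
          exact mul_le_mul_left (hq ζ) _
      _ ≤ 4 * S * (3 * J ρ) := by
          rw [lintegral_const_mul _
            (stronglyMeasurable_kernelAverage hφ hρ.1.le hρ.2).measurable.enorm]
          gcongr
          exact lintegral_enorm_kernelAverage_le hφ hC hρ.1.le hρ.2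
      _ = _ := by ring
  have hJm : Measurable J := by
    have hm := measurable_modulus hφ
    have hc := measurable_circle_coe
    refine Measurable.lintegral_prod_right' (ν := circleMeasure)
      (f := fun p : ℝ × Circle => modulus φ p.2 * (‖(p.2 : ℂ) - (p.1 : ℝ)‖ₑ ^ 2)⁻¹) ?_
    fun_prop
  rw [integral_eval_mul_eq hφ hC]
  calc _ ≤ ‖Q.eval 0‖ₑ * ‖∫ ζ, φ ζ ∂circleMeasure‖ₑ + ∫⁻ ρ in Set.Ioo (0 : ℝ) 1,
        ‖((2 * (1 - ρ ^ 2) : ℝ) : ℂ) * ∫ ζ : Circle, ζ * Q.derivative.eval (ρ * ζ : ℂ) *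
          kernelAverage φ ρ ζ ∂circleMeasure‖ₑ := by
        refine (enorm_add_le _ _).trans ?_
        rw [enorm_mul]
        gcongr
        exact enorm_integral_le_lintegral_enorm _
    _ ≤ ‖Q.eval 0‖ₑ * ENNReal.ofReal C + ∫⁻ ρ in Set.Ioo (0 : ℝ) 1, 12 * S * J ρ := by
        gcongr ?_ + ?_
        · gcongr
        · exact setLIntegral_mono' measurableSet_Ioo hpt
    _ ≤ ‖Q.eval 0‖ₑ * ENNReal.ofReal C + S * (12 * ∫⁻ r in Set.Ioo (0 : ℝ) 2, J r) := by
        gcongr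
        rw [lintegral_const_mul _ hJm, mul_comm 12 S, mul_assoc]
        gcongr
        norm_num
    _ ≤ _ := by
        rw [blochNorm, ← hS, mul_add]
        gcongr
        · exact le_self_add
        · exact le_add_self

/-! ### Rigidity -/

theorem isDini_mul_zpow {φ : Circle → ℂ} (hφ : Measurable φ) {C : ℝ}
    (hC : ∀ ζ, ‖φ ζ‖ ≤ C) (hd : IsDini φ) (n : ℤ) : IsDini (fun ζ => φ ζ * (ζ : ℂ) ^ n) := by
  refine hd.mul hφ hC (B := 1) (L := |(n : ℝ)|) (fun ζ => by simp [Circle.norm_coe])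
    fun t ht ζ => ?_
  have h1 : ((Circle.exp t * ζ : Circle) : ℂ) ^ n - (ζ : ℂ) ^ n =
      (ζ : ℂ) ^ n * ((Circle.exp (n * t) : ℂ) - 1) := by
    have h2 : Circle.exp (n * t) = Circle.exp t ^ n := by
      rw [← zsmul_eq_mul, Circle.exp_zsmul]
    rw [h2, Circle.coe_mul, mul_zpow, Circle.coe_zpow]
    ring
  rw [h1, norm_mul, norm_zpow, Circle.norm_coe, one_zpow, one_mul]
  refine (norm_exp_sub_one_le _).trans ?_
  rw [abs_mul, abs_of_pos ht]

theorem blochNorm_sub_le {f₁ f₂ h₁ h₂ : ℂ → ℂ}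
    (hf₁ : DifferentiableOn ℂ f₁ (Metric.ball 0 1)) (hf₂ : DifferentiableOn ℂ f₂ (Metric.ball 0 1))
    (heq : Set.EqOn f₁ f₂ (Metric.ball 0 1)) (hh₁ : Differentiable ℂ h₁)
    (hh₂ : Differentiable ℂ h₂) :
    blochNorm (fun z => h₁ z - h₂ z) ≤
      blochNorm (fun z => h₁ z - f₁ z) + blochNorm (fun z => h₂ z - f₂ z) := by
  simp only [blochNorm]
  rw [add_add_add_comm]
  gcongr ?_ + ?_
  · have h0 := heq (Metric.mem_ball_self one_pos)
    rw [show h₁ 0 - h₂ 0 = (h₁ 0 - f₁ 0) - (h₂ 0 - f₂ 0) by rw [h0]; ring]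
    exact enorm_sub_le
  · refine iSup₂_le fun z hz => ?_
    have hnhds := Metric.isOpen_ball.mem_nhds hz
    have hd₁ := (hf₁ z hz).differentiableAt hnhds
    have hd₂ := (hf₂ z hz).differentiableAt hnhds
    have hder : deriv f₁ z = deriv f₂ z := (heq.eventuallyEq_of_mem hnhds).deriv_eq
    have hz1 : 0 ≤ 1 - ‖z‖ := by
      have := mem_ball_zero_iff.1 hz
      linarith
    have h3 := le_iSup₂ (f := fun (z : ℂ) (_ : z ∈ Metric.ball (0 : ℂ) 1) =>
          ENNReal.ofReal ((1 - ‖z‖) * ‖deriv (fun z => h₁ z - f₁ z) z‖)) z hz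
    have h4 := le_iSup₂ (f := fun (z : ℂ) (_ : z ∈ Metric.ball (0 : ℂ) 1) =>
          ENNReal.ofReal ((1 - ‖z‖) * ‖deriv (fun z => h₂ z - f₂ z) z‖)) z hz
    refine le_trans ?_ (add_le_add h3 h4)
    rw [← ENNReal.ofReal_add (by positivity) (by positivity), ← mul_add]
    apply ENNReal.ofReal_le_ofReal
    gcongr
    rw [deriv_fun_sub (hh₁ z) (hh₂ z), deriv_fun_sub (hh₁ z) hd₁, deriv_fun_sub (hh₂ z) hd₂, hder]
    rw [show deriv h₁ z - deriv h₂ z =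
      (deriv h₁ z - deriv f₂ z) - (deriv h₂ z - deriv f₂ z) by ring]
    exact norm_sub_le _ _

/-- If `(f, g₁)` and `(f, g₂)` both lie in the closure, polynomials `Q₁ - Q₂` of small Bloch norm
approximate `g₁ - g₂` weakly on `E`. Testing against the Dini functions `1_E ζⁿ` shows that all
Fourier coefficients of `1_E (g₁ - g₂)` vanish. -/
theorem isSetOfRigidity_of_measurableSet {E : Set Circle} (hE : MeasurableSet E)
    (ht : translationIntegral E < ⊤) : IsSetOfRigidity E := by
  intro f₁ f₂ g₁ g₂ ⟨hf₁, hg₁, hc₁⟩ ⟨hf₂, hg₂, hc₂⟩ heq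
  have hc := measurable_circle_coe
  have hg : MemLp (fun ζ => g₁ ζ - g₂ ζ) ⊤ (circleMeasure.restrict E) := hg₁.sub hg₂
  have hmem : MemLp (E.indicator fun ζ => g₁ ζ - g₂ ζ) ⊤ circleMeasure :=
    (memLp_indicator_iff_restrict hE).2 hg
  have hzpow : ∀ n : ℤ, Measurable fun ζ : Circle => (ζ : ℂ) ^ n := fun n => by fun_prop
  have hzint : ∀ n : ℤ, Integrable (fun ζ : Circle => (ζ : ℂ) ^ n) (circleMeasure.restrict E) :=
    fun n => Integrable.of_bound (C := 1) (hzpow n).aestronglyMeasurable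
      (Eventually.of_forall fun ζ => by simp [Circle.norm_coe])
  have hmul : ∀ {g : Circle → ℂ}, Integrable g (circleMeasure.restrict E) → ∀ n : ℤ,
      Integrable (fun ζ => g ζ * (ζ : ℂ) ^ n) (circleMeasure.restrict E) := fun hg n =>
    hg.mul_bdd (c := 1) (hzpow n).aestronglyMeasurable
      (Eventually.of_forall fun ζ => by simp [Circle.norm_coe])
  have hi₁ : Integrable g₁ (circleMeasure.restrict E) := hg₁.integrable le_top
  have hi₂ : Integrable g₂ (circleMeasure.restrict E) := hg₂.integrable le_top
  have hiQ : ∀ Q : Polynomial ℂ, Integrable (fun ζ : Circle => Q.eval (ζ : ℂ))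
      (circleMeasure.restrict E) := fun Q =>
    (integrable_of_continuous_circle (by fun_prop)).restrict
  have hzero : E.indicator (fun ζ => g₁ ζ - g₂ ζ) =ᵐ[circleMeasure] 0 := by
    refine ae_eq_zero_of_forall_integral_zpow_eq_zero hmem fun n => ?_
    have hχm : Measurable (E.indicator (1 : Circle → ℂ)) := measurable_one.indicator hE
    have hχ : ∀ ζ, ‖E.indicator (1 : Circle → ℂ) ζ‖ ≤ 1 := fun ζ => by
      by_cases h : ζ ∈ E <;> simp [h]
    have hdini := isDini_mul_zpow hχm hχ ((isDini_indicator_iff hE).2 ht) n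
    set φ : Circle → ℂ := fun ζ => E.indicator (1 : Circle → ℂ) ζ * (ζ : ℂ) ^ n with hφ
    have hφm : Measurable φ := hχm.mul (hzpow n)
    have hφ1 : ∀ ζ, ‖φ ζ‖ ≤ 1 := fun ζ => by
      rw [hφ, norm_mul, norm_zpow, Circle.norm_coe, one_zpow, mul_one]; exact hχ ζ
    obtain ⟨D, hD0, hD⟩ : ∃ D : ℝ, 0 ≤ D ∧ ∀ Q : Polynomial ℂ, ∀ ε : ℝ, 0 ≤ ε →
        blochNorm (fun z => Q.eval z) ≤ ENNReal.ofReal ε →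
        ‖∫ ζ : Circle, Q.eval (ζ : ℂ) * φ ζ ∂circleMeasure‖ ≤ ε * D := by
      have hfin := hdini.lintegral_kernel_lt_top hφm hφ1
      set M := ENNReal.ofReal 1 + 12 * ∫⁻ r in Set.Ioo (0 : ℝ) 2,
        ∫⁻ ξ : Circle, modulus φ ξ * (‖(ξ : ℂ) - (r : ℝ)‖ₑ ^ 2)⁻¹ ∂circleMeasure with hM
      have hMt : M ≠ ⊤ := by
        rw [hM]
        exact ENNReal.add_ne_top.2 ⟨by simp, ENNReal.mul_ne_top (by simp) hfin.ne⟩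
      refine ⟨M.toReal, ENNReal.toReal_nonneg, fun Q ε hε hQ => ?_⟩
      have h1 := (enorm_integral_eval_mul_le hφm hφ1 Q).trans (mul_le_mul_left hQ _)
      rw [← ofReal_norm, ← hM, ← ENNReal.ofReal_toReal hMt, ← ENNReal.ofReal_mul hε] at h1
      exact (ENNReal.ofReal_le_ofReal_iff (by positivity)).1 h1
    have hkey : ∀ ε : ℝ, 0 < ε →
        ‖∫ ζ : Circle, E.indicator (fun ζ => g₁ ζ - g₂ ζ) ζ * (ζ : ℂ) ^ n ∂circleMeasure‖ ≤
          ε * (2 * D + 2) := by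
      intro ε hε
      obtain ⟨Q₁, hB₁, hw₁⟩ := hc₁ {fun ζ : Circle => (ζ : ℂ) ^ n} (by simpa using hzint n) ε hε
      obtain ⟨Q₂, hB₂, hw₂⟩ := hc₂ {fun ζ : Circle => (ζ : ℂ) ^ n} (by simpa using hzint n) ε hε
      replace hw₁ := hw₁ _ (Finset.mem_singleton_self _)
      replace hw₂ := hw₂ _ (Finset.mem_singleton_self _)
      have hBQ : blochNorm (fun z => (Q₁ - Q₂).eval z) ≤ ENNReal.ofReal (2 * ε) := by
        simp only [Polynomial.eval_sub]
        refine (blochNorm_sub_le hf₁.1 hf₂.1 heq Q₁.differentiable Q₂.differentiable).trans ?_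
        rw [two_mul, ENNReal.ofReal_add hε.le hε.le]
        exact add_le_add hB₁.le hB₂.le
      have h1 := hD _ _ (by positivity) hBQ
      have h2 : ∫ ζ : Circle, (Q₁ - Q₂).eval (ζ : ℂ) * φ ζ ∂circleMeasure =
          ∫ ζ in E, (Q₁ - Q₂).eval (ζ : ℂ) * (ζ : ℂ) ^ n ∂circleMeasure := by
        rw [← integral_indicator hE]
        refine integral_congr_ae (Eventually.of_forall fun ζ => ?_)
        by_cases h : ζ ∈ E <;> simp [hφ, h]
      have h3 : ∫ ζ : Circle, E.indicator (fun ζ => g₁ ζ - g₂ ζ) ζ * (ζ : ℂ) ^ n ∂circleMeasure =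
          ∫ ζ in E, (g₁ ζ - g₂ ζ) * (ζ : ℂ) ^ n ∂circleMeasure := by
        rw [← integral_indicator hE]
        refine integral_congr_ae (Eventually.of_forall fun ζ => ?_)
        by_cases h : ζ ∈ E <;> simp [h]
      have h4 : ∫ ζ in E, (g₁ ζ - g₂ ζ) * (ζ : ℂ) ^ n ∂circleMeasure =
          (∫ ζ in E, (Q₁ - Q₂).eval (ζ : ℂ) * (ζ : ℂ) ^ n ∂circleMeasure) -
          (∫ ζ in E, (Q₁.eval (ζ : ℂ) - g₁ ζ) * (ζ : ℂ) ^ n ∂circleMeasure) +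
          ∫ ζ in E, (Q₂.eval (ζ : ℂ) - g₂ ζ) * (ζ : ℂ) ^ n ∂circleMeasure := by
        have a := hmul (hiQ (Q₁ - Q₂)) n
        have b : Integrable (fun ζ : Circle => (Q₁.eval (ζ : ℂ) - g₁ ζ) * (ζ : ℂ) ^ n)
          (circleMeasure.restrict E) := hmul ((hiQ Q₁).sub hi₁) n
        have c : Integrable (fun ζ : Circle => (Q₂.eval (ζ : ℂ) - g₂ ζ) * (ζ : ℂ) ^ n)
          (circleMeasure.restrict E) := hmul ((hiQ Q₂).sub hi₂) n
        have ab : Integrable (fun ζ : Circle => (Q₁ - Q₂).eval (ζ : ℂ) * (ζ : ℂ) ^ n -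
          (Q₁.eval (ζ : ℂ) - g₁ ζ) * (ζ : ℂ) ^ n) (circleMeasure.restrict E) := a.sub b
        rw [← integral_sub a b, ← integral_add ab c]
        refine integral_congr_ae (Eventually.of_forall fun ζ => ?_)
        simp only [Polynomial.eval_sub]
        ring
      rw [h2] at h1
      rw [h3, h4]
      refine (norm_add_le _ _).trans ?_
      have := norm_sub_le
        (∫ ζ in E, (Q₁ - Q₂).eval (ζ : ℂ) * (ζ : ℂ) ^ n ∂circleMeasure)
        (∫ ζ in E, (Q₁.eval (ζ : ℂ) - g₁ ζ) * (ζ : ℂ) ^ n ∂circleMeasure)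
      linarith
    refine norm_le_zero_iff.1 (le_of_forall_pos_le_add fun δ hδ => ?_)
    refine (hkey (δ / (2 * D + 2)) (by positivity)).trans ?_
    rw [div_mul_cancel₀ _ (by positivity), zero_add]
  rw [EventuallyEq, ae_restrict_iff' hE]
  filter_upwards [hzero] with ζ h hζ
  simpa [hζ, sub_eq_zero] using h

/-! ### A compactly supported Dini density inside a set with the Dini property -/

theorem enorm_iInf_sub_iInf_le {f g : ℕ → ℝ} (hf : ∀ k, 0 ≤ f k) (hg : ∀ k, 0 ≤ g k) :
    ‖(⨅ k, f k) - ⨅ k, g k‖ₑ ≤ ∑' k, ‖f k - g k‖ₑ := by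
  by_cases htop : ∑' k, ‖f k - g k‖ₑ = ⊤
  · rw [htop]; exact le_top
  set D := (∑' k, ‖f k - g k‖ₑ).toReal with hD
  have hle : ∀ k, |f k - g k| ≤ D := fun k => by
    have h1 := ENNReal.toReal_mono htop (ENNReal.le_tsum (f := fun k => ‖f k - g k‖ₑ) k)
    rwa [toReal_enorm, Real.norm_eq_abs] at h1
  have hbf : BddBelow (Set.range f) := ⟨0, by rintro _ ⟨k, rfl⟩; exact hf k⟩
  have hbg : BddBelow (Set.range g) := ⟨0, by rintro _ ⟨k, rfl⟩; exact hg k⟩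
  have h1 : (⨅ k, f k) - D ≤ ⨅ k, g k := le_ciInf fun k => by
    have := ciInf_le hbf k
    have := (abs_le.1 (hle k)).2
    linarith
  have h2 : (⨅ k, g k) - D ≤ ⨅ k, f k := le_ciInf fun k => by
    have := ciInf_le hbg k
    have := (abs_le.1 (hle k)).1
    linarith
  rw [← ENNReal.ofReal_toReal htop, ← hD, ← ofReal_norm, Real.norm_eq_abs]
  exact ENNReal.ofReal_le_ofReal (abs_le.2 ⟨by linarith, by linarith⟩)

/-- The average of `χ` over the part `(δ/2, δ)` of the arc in front of `ζ`. Leaving out `(0, δ/2)`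
makes the `L¹` distance to `χ` bounded by one dyadic piece of the Dini integral. -/
noncomputable def arcAverage (χ : Circle → ℝ) (δ : ℝ) (ζ : Circle) : ℝ :=
  2 / δ * ∫ s in Set.Ioo (δ / 2) δ, χ (Circle.exp s * ζ)

section ArcAverage

variable {χ : Circle → ℝ} {δ : ℝ}

theorem integrableOn_rotation (hχ : Measurable χ) (hχ0 : ∀ ζ, 0 ≤ χ ζ) (hχ1 : ∀ ζ, χ ζ ≤ 1)
    {S : Set ℝ} (hS : volume S ≠ ⊤) (ζ : Circle) :
    IntegrableOn (fun s : ℝ => χ (Circle.exp s * ζ)) S := by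
  have := measurable_circle_exp
  refine Measure.integrableOn_of_bounded (M := 1) hS
    (Measurable.aestronglyMeasurable (by fun_prop)) (Eventually.of_forall fun s => ?_)
  rw [Real.norm_of_nonneg (hχ0 _)]
  exact hχ1 _

theorem two_div_mul_setIntegral_const (hδ : 0 < δ) (c : ℝ) :
    2 / δ * ∫ _ in Set.Ioo (δ / 2) δ, c = c := by
  rw [setIntegral_const, Real.volume_real_Ioo_of_le (by linarith), smul_eq_mul]
  field_simp
  ring

theorem arcAverage_le_one (hχ : Measurable χ) (hχ0 : ∀ ζ, 0 ≤ χ ζ) (hχ1 : ∀ ζ, χ ζ ≤ 1)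
    (hδ : 0 < δ) (ζ : Circle) : arcAverage χ δ ζ ≤ 1 := by
  rw [← two_div_mul_setIntegral_const hδ 1, arcAverage]
  refine mul_le_mul_of_nonneg_left ?_ (by positivity)
  exact setIntegral_mono (integrableOn_rotation hχ hχ0 hχ1 (S := Set.Ioo (δ / 2) δ) (by simp) ζ)
    (by simp) fun s => hχ1 _

theorem continuous_arcAverage (hχ : Measurable χ) (hχ0 : ∀ ζ, 0 ≤ χ ζ) (hχ1 : ∀ ζ, χ ζ ≤ 1)
    (hδ : 0 < δ) : Continuous (arcAverage χ δ) := by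
  -- Lifted to the line, the average is a difference of values of a primitive.
  have hq : IsQuotientMap (Circle.exp : ℝ → Circle) :=
    Circle.isCoveringMap_exp.isLocalHomeomorph.isOpenMap.isQuotientMap (by fun_prop)
      Circle.exp_surjective
  rw [hq.continuous_iff]
  have hint : ∀ a b : ℝ, IntervalIntegrable (fun s : ℝ => χ (Circle.exp s)) volume a b :=
    fun a b => by
    rw [intervalIntegrable_iff]
    simpa using integrableOn_rotation hχ hχ0 hχ1 (S := Set.uIoc a b) (by simp [Set.uIoc]) 1
  have hF := intervalIntegral.continuous_primitive hint 0
  have heq : arcAverage χ δ ∘ Circle.exp = fun θ => 2 / δ *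
      ((∫ s in (0 : ℝ)..(δ + θ), χ (Circle.exp s)) -
        ∫ s in (0 : ℝ)..(δ / 2 + θ), χ (Circle.exp s)) := by
    ext θ
    rw [intervalIntegral.integral_interval_sub_left (hint _ _) (hint _ _),
      ← intervalIntegral.integral_comp_add_right, intervalIntegral.integral_of_le (by linarith),
      integral_Ioc_eq_integral_Ioo]
    simp only [Function.comp, arcAverage, Circle.exp_add]
  rw [heq]
  exact continuous_const.mul ((hF.comp (continuous_const.add continuous_id)).sub
    (hF.comp (continuous_const.add continuous_id)))

theorem lintegral_enorm_arcAverage_sub_le (hχ : Measurable χ) (hχ0 : ∀ ζ, 0 ≤ χ ζ)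
    (hχ1 : ∀ ζ, χ ζ ≤ 1) (hδ : 0 < δ) (ξ : Circle) :
    ∫⁻ ζ, ‖arcAverage χ δ (ξ * ζ) - arcAverage χ δ ζ‖ₑ ∂circleMeasure ≤
      ∫⁻ ζ, ‖χ (ξ * ζ) - χ ζ‖ₑ ∂circleMeasure := by
  have hem := measurable_circle_exp
  have hpt : ∀ ζ, ‖arcAverage χ δ (ξ * ζ) - arcAverage χ δ ζ‖ₑ ≤ ENNReal.ofReal (2 / δ) *
      ∫⁻ s in Set.Ioo (δ / 2) δ, ‖χ (ξ * (Circle.exp s * ζ)) - χ (Circle.exp s * ζ)‖ₑ :=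
    fun ζ => by
    rw [arcAverage, arcAverage, ← mul_sub,
      ← integral_sub (integrableOn_rotation hχ hχ0 hχ1 (by simp) _)
        (integrableOn_rotation hχ hχ0 hχ1 (by simp) _), enorm_mul,
      Real.enorm_of_nonneg (by positivity)]
    gcongr
    simp only [mul_left_comm _ ξ]
    exact enorm_integral_le_lintegral_enorm _
  refine (lintegral_mono hpt).trans ?_
  rw [lintegral_const_mul' _ _ ENNReal.ofReal_ne_top,
    lintegral_lintegral_swap (by apply Measurable.aemeasurable; fun_prop)]
  simp only [lintegral_mul_left_eq_self (μ := circleMeasure) (fun ζ => ‖χ (ξ * ζ) - χ ζ‖ₑ)]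
  rw [setLIntegral_const, Real.volume_Ioo, mul_left_comm, ← ENNReal.ofReal_mul (by positivity),
    show 2 / δ * (δ - δ / 2) = 1 by field_simp; ring]
  simp

theorem lintegral_enorm_arcAverage_sub_self_le (hχ : Measurable χ) (hχ0 : ∀ ζ, 0 ≤ χ ζ)
    (hχ1 : ∀ ζ, χ ζ ≤ 1) (hδ : 0 < δ) :
    ∫⁻ ζ, ‖arcAverage χ δ ζ - χ ζ‖ₑ ∂circleMeasure ≤
      2 * ∫⁻ s in Set.Ioo (δ / 2) δ,
        (∫⁻ ζ, ‖χ (Circle.exp s * ζ) - χ ζ‖ₑ ∂circleMeasure) / ENNReal.ofReal s := by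
  have hem := measurable_circle_exp
  have hpt : ∀ ζ, ‖arcAverage χ δ ζ - χ ζ‖ₑ ≤ ENNReal.ofReal (2 / δ) *
      ∫⁻ s in Set.Ioo (δ / 2) δ, ‖χ (Circle.exp s * ζ) - χ ζ‖ₑ := fun ζ => by
    have h1 : arcAverage χ δ ζ - χ ζ =
        2 / δ * ∫ s in Set.Ioo (δ / 2) δ, (χ (Circle.exp s * ζ) - χ ζ) := by
      rw [integral_sub (integrableOn_rotation hχ hχ0 hχ1 (by simp) _) (by simp), mul_sub,
        two_div_mul_setIntegral_const hδ, arcAverage]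
    rw [h1, enorm_mul, Real.enorm_of_nonneg (by positivity)]
    gcongr
    exact enorm_integral_le_lintegral_enorm _
  refine (lintegral_mono hpt).trans ?_
  rw [lintegral_const_mul' _ _ ENNReal.ofReal_ne_top,
    lintegral_lintegral_swap (by apply Measurable.aemeasurable; fun_prop),
    ← lintegral_const_mul' _ _ ENNReal.ofReal_ne_top, ← lintegral_const_mul' _ _ (by simp)]
  refine setLIntegral_mono' measurableSet_Ioo fun s hs => ?_
  have hs0 : 0 < s := by have := hs.1; linarith
  rw [ENNReal.div_eq_inv_mul, ← mul_assoc]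
  gcongr
  rw [← ENNReal.ofReal_inv_of_pos hs0, ← ENNReal.ofReal_ofNat, ← ENNReal.ofReal_mul (by norm_num),
    div_eq_mul_inv]
  have := hs.2.le
  apply ENNReal.ofReal_le_ofReal
  gcongr

end ArcAverage

theorem not_summable_of_eventually_div_le {a : ℕ → ℝ} {ε : ℝ} (hε : 0 < ε)
    (h : ∀ᶠ n : ℕ in atTop, ε / (n + 1) ≤ a n) : ¬ Summable a := by
  intro hs
  obtain ⟨N, hN⟩ := eventually_atTop.1 h
  have h1 := (summable_nat_add_iff N).2 hs
  have h2 : Summable fun n : ℕ => ε / ((n + N : ℕ) + 1) :=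
    Summable.of_nonneg_of_le (fun n => by positivity) (fun n => hN (n + N) (by omega)) h1
  have h3 := (summable_nat_add_iff (f := fun n : ℕ => ε / ((n : ℝ) + 1)) N).1 h2
  have h4 := (h3.mul_left ε⁻¹)
  refine Real.not_summable_one_div_natCast ((summable_nat_add_iff 1).1 (h4.congr fun n => ?_))
  push_cast
  field_simp

/-- If `∫₀¹ F < ∞` then there are arbitrarily small dyadic scales `2⁻ⁿ` at which both the tail of
the integral and `n + 1` times the dyadic piece of the integral are small. -/
theorem exists_dyadic_scale {F : ℝ → ENNReal} (hF : ∫⁻ t in Set.Ioo (0 : ℝ) 1, F t < ⊤)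
    {ε : ENNReal} (hε : 0 < ε) :
    ∃ n : ℕ, (n + 1 : ENNReal) * ∫⁻ t in Set.Ioo ((1 / 2 : ℝ) ^ n / 2) ((1 / 2 : ℝ) ^ n), F t ≤ ε ∧
      ∫⁻ t in Set.Ioo (0 : ℝ) ((1 / 2 : ℝ) ^ n), F t ≤ ε := by
  wlog hεt : ε ≠ ⊤ generalizing ε
  · obtain ⟨n, h1, h2⟩ := this (ε := 1) one_pos (by simp)
    rw [not_not.1 hεt]
    exact ⟨n, le_top, le_top⟩
  set I : ℕ → Set ℝ := fun n => Set.Ioo ((1 / 2 : ℝ) ^ n / 2) ((1 / 2 : ℝ) ^ n) with hI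
  set a : ℕ → ENNReal := fun n => ∫⁻ t in I n, F t with ha
  have hpow : ∀ n : ℕ, (1 / 2 : ℝ) ^ n ≤ 1 := fun n => pow_le_one₀ (by norm_num) (by norm_num)
  have hsum : ∑' n, a n ≠ ⊤ := by
    refine (lt_of_le_of_lt ?_ hF).ne
    rw [ha, ← lintegral_iUnion (fun n => measurableSet_Ioo)]
    · refine lintegral_mono_set (Set.iUnion_subset fun n t ht => ⟨?_, ht.2.trans_le (hpow n)⟩)
      exact lt_trans (by positivity) ht.1
    · intro i j hij
      rcases lt_or_gt_of_ne hij with h | h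
      all_goals
        refine Set.disjoint_left.2 fun t ht ht' => ?_
        have h1 := pow_le_pow_of_le_one (by norm_num : (0 : ℝ) ≤ 1 / 2) (by norm_num)
          (Nat.succ_le_of_lt h)
        rw [pow_succ] at h1
        have := ht.1
        have := ht.2
        have := ht'.1
        have := ht'.2
        linarith
  have htail : Tendsto (fun n : ℕ => ∫⁻ t in Set.Ioo (0 : ℝ) ((1 / 2 : ℝ) ^ n), F t) atTop
      (𝓝 0) := by
    have h1 := tendsto_setLIntegral_zero (μ := volume.restrict (Set.Ioo (0 : ℝ) 1)) (f := F) hF.ne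
      (s := fun n : ℕ => Set.Ioo (0 : ℝ) ((1 / 2 : ℝ) ^ n)) (l := atTop) (by
        have h2 : Tendsto (fun n : ℕ => ENNReal.ofReal ((1 / 2 : ℝ) ^ n)) atTop (𝓝 0) := by
          rw [← ENNReal.ofReal_zero]
          exact (ENNReal.continuous_ofReal.tendsto 0).comp
            (tendsto_pow_atTop_nhds_zero_of_lt_one (by norm_num) (by norm_num))
        refine tendsto_of_tendsto_of_tendsto_of_le_of_le tendsto_const_nhds h2
          (fun _ => zero_le) fun n => ?_
        exact (Measure.restrict_apply_le _ _).trans (by simp))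
    refine h1.congr fun n => ?_
    rw [Measure.restrict_restrict measurableSet_Ioo,
      Set.inter_eq_left.2 (Set.Ioo_subset_Ioo_right (hpow n))]
  -- Otherwise the dyadic pieces dominate the harmonic series.
  by_contra hcon
  push Not at hcon
  have hev : ∀ᶠ n : ℕ in atTop, ε.toReal / (n + 1) ≤ (a n).toReal := by
    filter_upwards [htail.eventually (ge_mem_nhds hε)] with n hn
    have h1 : ε < (n + 1 : ENNReal) * a n := by
      by_contra h2
      exact absurd hn (not_le.2 (hcon n (not_lt.1 h2)))
    have hat : a n ≠ ⊤ := ENNReal.ne_top_of_tsum_ne_top hsum n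
    have h2 := ENNReal.toReal_mono (ENNReal.mul_ne_top (by finiteness) hat) h1.le
    rw [ENNReal.toReal_mul] at h2
    rw [div_le_iff₀ (by positivity), mul_comm]
    refine h2.trans_eq ?_
    congr 1
  exact not_summable_of_eventually_div_le (ENNReal.toReal_pos hε.ne' hεt) hev
    (ENNReal.summable_toReal hsum)

theorem lintegral_inv_Ico {a : ℝ} (hpos : 0 < a) (hle : a ≤ 1) :
    ∫⁻ t in Set.Ico a 1, (ENNReal.ofReal t)⁻¹ = ENNReal.ofReal (Real.log (1 / a)) := by
  have h1 : ∫⁻ t in Set.Ico a 1, (ENNReal.ofReal t)⁻¹ =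
      ∫⁻ t in Set.Ioc a 1, ENNReal.ofReal t⁻¹ := by
    rw [restrict_Ico_eq_restrict_Ioc]
    refine setLIntegral_congr_fun measurableSet_Ioc fun t ht => ?_
    exact (ENNReal.ofReal_inv_of_pos (hpos.trans ht.1)).symm
  have hint : IntervalIntegrable (fun t : ℝ => t⁻¹) volume a 1 := by
    rw [intervalIntegrable_inv_iff]
    right
    rw [Set.uIcc_of_le hle]
    exact fun h => absurd h.1 (not_le.2 hpos)
  rw [h1, ← ofReal_integral_eq_lintegral_ofReal
    ((intervalIntegrable_iff_integrableOn_Ioc_of_le hle).1 hint),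
    ← intervalIntegral.integral_of_le hle, integral_inv_of_pos hpos one_pos]
  filter_upwards [ae_restrict_mem measurableSet_Ioc] with t ht
  exact (inv_pos.2 (hpos.trans ht.1)).le

theorem lintegral_inv_dyadic_le (n : ℕ) :
    ∫⁻ t in Set.Ico ((1 / 2 : ℝ) ^ n) 1, (ENNReal.ofReal t)⁻¹ ≤ (n + 1 : ENNReal) := by
  rw [lintegral_inv_Ico (by positivity) (pow_le_one₀ (by norm_num) (by norm_num))]
  have h2 : Real.log (1 / (1 / 2 : ℝ) ^ n) ≤ n + 1 := by
    rw [one_div, ← inv_pow, Real.log_pow]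
    norm_num
    have := Real.log_two_lt_d9
    nlinarith [(Nat.cast_nonneg n : (0 : ℝ) ≤ n)]
  refine (ENNReal.ofReal_le_ofReal h2).trans (le_of_eq ?_)
  rw [ENNReal.ofReal_add (by positivity) zero_le_one]
  simp

theorem modulus_ofReal (h : Circle → ℝ) (ξ : Circle) :
    modulus (fun ζ => (h ζ : ℂ)) ξ = ∫⁻ ζ, ‖h (ξ * ζ) - h ζ‖ₑ ∂circleMeasure := by
  refine lintegral_congr fun ζ => ?_
  rw [← Complex.ofReal_sub, ← ofReal_norm, ← ofReal_norm, Complex.norm_real]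

/-- The ramp `max 0 (2u - 1)`, which vanishes for `u ≤ 1/2` and equals `1` at `u = 1`. -/
noncomputable def ramp (u : ℝ) : ℝ := max 0 (2 * u - 1)

theorem ramp_nonneg (u : ℝ) : 0 ≤ ramp u := le_max_left _ _

theorem ramp_le_one {u : ℝ} (hu : u ≤ 1) : ramp u ≤ 1 := max_le zero_le_one (by linarith)

theorem enorm_ramp_sub_le (u v : ℝ) : ‖ramp u - ramp v‖ₑ ≤ 2 * ‖u - v‖ₑ := by
  rw [← ofReal_norm, ← ofReal_norm, ← ENNReal.ofReal_ofNat, ← ENNReal.ofReal_mul (by norm_num)]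
  apply ENNReal.ofReal_le_ofReal
  have h := abs_max_sub_max_le_max 0 (2 * u - 1) 0 (2 * v - 1)
  rw [Real.norm_eq_abs, Real.norm_eq_abs]
  refine h.trans (max_le (by simp) ?_)
  rw [show 2 * u - 1 - (2 * v - 1) = 2 * (u - v) by ring, abs_mul, abs_two]

theorem ramp_eq_zero {u : ℝ} (hu : u ≤ 1 / 2) : ramp u = 0 := max_eq_left (by linarith)

@[simp] theorem ramp_one : ramp 1 = 1 := by norm_num [ramp]

theorem continuous_ramp : Continuous ramp := by unfold ramp; fun_prop

/-- Oscillation of the ramped average of `χ = 1_E` at the scale `2⁻ⁿ` along pairs of points of `E`.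
For `t < 2⁻ⁿ` it is controlled by the modulus of `χ`, for `t ≥ 2⁻ⁿ` by the distance from the
average to `χ`. -/
theorem lintegral_ramp_arcAverage_le {E : Set Circle} (hE : MeasurableSet E) (n : ℕ) {ε : ENNReal}
    (h1 : (n + 1 : ENNReal) * ∫⁻ t in Set.Ioo ((1 / 2 : ℝ) ^ n / 2) ((1 / 2 : ℝ) ^ n),
      modulus (fun ζ => ((E.indicator 1 ζ : ℝ) : ℂ)) (Circle.exp t) /
        ENNReal.ofReal t ≤ ε)
    (h2 : ∫⁻ t in Set.Ioo (0 : ℝ) ((1 / 2 : ℝ) ^ n),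
      modulus (fun ζ => ((E.indicator 1 ζ : ℝ) : ℂ)) (Circle.exp t) /
        ENNReal.ofReal t ≤ ε) :
    ∫⁻ t in Set.Ioo (0 : ℝ) 1, (∫⁻ ζ, {ζ | ζ ∈ E ∧ Circle.exp t * ζ ∈ E}.indicator
      (fun ζ => ‖ramp (arcAverage (E.indicator 1) ((1 / 2 : ℝ) ^ n) (Circle.exp t * ζ)) -
        ramp (arcAverage (E.indicator 1) ((1 / 2 : ℝ) ^ n) ζ)‖ₑ) ζ ∂circleMeasure) /
        ENNReal.ofReal t ≤ 10 * ε ∧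
    ∫⁻ ζ, E.indicator (fun ζ => ‖1 - ramp (arcAverage (E.indicator 1) ((1 / 2 : ℝ) ^ n) ζ)‖ₑ) ζ
      ∂circleMeasure ≤ 4 * ε ∧
    ∫⁻ ζ, ‖arcAverage (E.indicator 1) ((1 / 2 : ℝ) ^ n) ζ - E.indicator 1 ζ‖ₑ
      ∂circleMeasure ≤ 2 * ε := by
  set χ : Circle → ℝ := E.indicator 1 with hχdef
  set δ : ℝ := (1 / 2 : ℝ) ^ n with hδdef
  have hδ : 0 < δ := by positivity
  have hδ1 : δ ≤ 1 := pow_le_one₀ (by norm_num) (by norm_num)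
  have hχ : Measurable χ := measurable_one.indicator hE
  have hχ0 : ∀ ζ, 0 ≤ χ ζ := fun ζ => Set.indicator_nonneg (fun _ _ => zero_le_one) ζ
  have hχ1 : ∀ ζ, χ ζ ≤ 1 := fun ζ => Set.indicator_le_self' (fun _ _ => zero_le_one) ζ
  simp only [modulus_ofReal] at h1 h2
  set u := arcAverage χ δ with hu
  have huc : Continuous u := continuous_arcAverage hχ hχ0 hχ1 hδ
  have hum := huc.measurable
  have hgm : Measurable fun ζ => ramp (u ζ) := (continuous_ramp.comp huc).measurable
  set a := ∫⁻ t in Set.Ioo (δ / 2) δ, (∫⁻ ζ, ‖χ (Circle.exp t * ζ) - χ ζ‖ₑ ∂circleMeasure) /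
        ENNReal.ofReal t with ha
  have haε : a ≤ ε := by
    refine le_trans ?_ h1
    calc a = 1 * a := (one_mul a).symm
      _ ≤ _ := by gcongr; exact le_add_self
  have hua : ∫⁻ ζ, ‖u ζ - χ ζ‖ₑ ∂circleMeasure ≤ 2 * a :=
    lintegral_enorm_arcAverage_sub_self_le hχ hχ0 hχ1 hδ
  have hga : ∫⁻ ζ, E.indicator (fun ζ => ‖1 - ramp (u ζ)‖ₑ) ζ ∂circleMeasure ≤ 4 * a := by
    calc _ ≤ ∫⁻ ζ, 2 * ‖u ζ - χ ζ‖ₑ ∂circleMeasure := by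
          refine lintegral_mono fun ζ => ?_
          by_cases h : ζ ∈ E
          · have hχζ : χ ζ = 1 := by simp [hχdef, h]
            rw [Set.indicator_of_mem h, hχζ, enorm_sub_rev (u ζ)]
            simpa using enorm_ramp_sub_le 1 (u ζ)
          · rw [Set.indicator_of_notMem h]; exact zero_le
      _ ≤ 2 * (2 * a) := by rw [lintegral_const_mul' _ _ (by simp)]; gcongr
      _ = _ := by ring
  refine ⟨?_, hga.trans (by gcongr), hua.trans (by gcongr)⟩
  set D : ℝ → ENNReal := fun t => ∫⁻ ζ, {ζ | ζ ∈ E ∧ Circle.exp t * ζ ∈ E}.indicator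
      (fun ζ => ‖ramp (u (Circle.exp t * ζ)) - ramp (u ζ)‖ₑ) ζ ∂circleMeasure with hD
  have hD1 : ∀ t, D t ≤ 2 * ∫⁻ ζ, ‖χ (Circle.exp t * ζ) - χ ζ‖ₑ ∂circleMeasure := fun t => by
    calc D t ≤ ∫⁻ ζ, 2 * ‖u (Circle.exp t * ζ) - u ζ‖ₑ ∂circleMeasure :=
          lintegral_mono fun ζ => (Set.indicator_le_self _ _ ζ).trans (enorm_ramp_sub_le _ _)
      _ ≤ _ := by
          rw [lintegral_const_mul' _ _ (by simp)]
          exact mul_le_mul_right (lintegral_enorm_arcAverage_sub_le hχ hχ0 hχ1 hδ _) _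
  have hD2 : ∀ t, D t ≤ 8 * a := fun t => by
    set G : Circle → ENNReal := E.indicator (fun ζ => ‖1 - ramp (u ζ)‖ₑ) with hG
    have hGm : Measurable G := (measurable_const.sub hgm).enorm.indicator hE
    calc D t ≤ ∫⁻ ζ, (G (Circle.exp t * ζ) + G ζ) ∂circleMeasure := by
          refine lintegral_mono fun ζ => ?_
          by_cases h : ζ ∈ E ∧ Circle.exp t * ζ ∈ E
          · rw [Set.indicator_of_mem (by exact h), hG, Set.indicator_of_mem h.1,
              Set.indicator_of_mem h.2, ← enorm_neg (1 - ramp (u (Circle.exp t * ζ)))]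
            refine le_trans (le_of_eq ?_) (enorm_add_le _ _)
            congr 1
            ring
          · rw [Set.indicator_of_notMem (by exact h)]; exact zero_le
      _ = (∫⁻ ζ, G ζ ∂circleMeasure) + ∫⁻ ζ, G ζ ∂circleMeasure := by
          rw [lintegral_add_right _ hGm, lintegral_mul_left_eq_self]
      _ ≤ 4 * a + 4 * a := add_le_add hga hga
      _ = _ := by ring
  have hsplit : Set.Ioo (0 : ℝ) 1 ⊆ Set.Ioo 0 δ ∪ Set.Ico δ 1 := fun t ht => by
    rcases lt_or_ge t δ with h | h
    · exact Or.inl ⟨ht.1, h⟩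
    · exact Or.inr ⟨h, ht.2⟩
  calc ∫⁻ t in Set.Ioo (0 : ℝ) 1, D t / ENNReal.ofReal t
      ≤ (∫⁻ t in Set.Ioo (0 : ℝ) δ, D t / ENNReal.ofReal t) +
          ∫⁻ t in Set.Ico δ 1, D t / ENNReal.ofReal t :=
        (lintegral_mono_set hsplit).trans (lintegral_union_le _ _ _)
    _ ≤ (∫⁻ t in Set.Ioo (0 : ℝ) δ, 2 * ((∫⁻ ζ, ‖χ (Circle.exp t * ζ) - χ ζ‖ₑ ∂circleMeasure) /
          ENNReal.ofReal t)) + ∫⁻ t in Set.Ico δ 1, 8 * a * (ENNReal.ofReal t)⁻¹ := by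
        gcongr with t t
        · rw [← mul_div_assoc]
          exact ENNReal.div_le_div_right (hD1 t) _
        · rw [div_eq_mul_inv]
          gcongr
          exact hD2 t
    _ ≤ 2 * ε + 8 * a * (n + 1) := by
        rw [lintegral_const_mul' _ _ (by simp), lintegral_const_mul _ (by fun_prop)]
        gcongr
        exact lintegral_inv_dyadic_le n
    _ ≤ 2 * ε + 8 * ε := by
        gcongr 2 * ε + ?_
        rw [mul_assoc, mul_comm a]
        gcongr
    _ = 10 * ε := by ring

theorem isDini_of_le_tsum {χ h : Circle → ℝ} (hχ : Measurable χ)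
    (hd : IsDini (fun ζ => (χ ζ : ℂ))) {d : ℕ → ℝ → Circle → ENNReal}
    (hdm : ∀ k, Measurable fun p : ℝ × Circle => d k p.1 p.2)
    (hpt : ∀ t ζ, ‖h (Circle.exp t * ζ) - h ζ‖ₑ ≤
      ‖χ (Circle.exp t * ζ) - χ ζ‖ₑ + ∑' k, d k t ζ) {ε : ℕ → ENNReal}
    (hε : ∀ k, ∫⁻ t in Set.Ioo (0 : ℝ) 1,
      (∫⁻ ζ, d k t ζ ∂circleMeasure) / ENNReal.ofReal t ≤ ε k)
    (hεtop : ∑' k, ε k ≠ ⊤) : IsDini (fun ζ => (h ζ : ℂ)) := by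
  have hωm : Measurable fun t : ℝ => modulus (fun ζ => (χ ζ : ℂ)) (Circle.exp t) :=
    (measurable_modulus (by fun_prop)).comp measurable_circle_exp
  have hDm : ∀ k, Measurable fun t : ℝ => ∫⁻ ζ, d k t ζ ∂circleMeasure := fun k =>
    (hdm k).lintegral_prod_right'
  have hmod : ∀ t : ℝ, modulus (fun ζ => (h ζ : ℂ)) (Circle.exp t) ≤
      modulus (fun ζ => (χ ζ : ℂ)) (Circle.exp t) +
        ∑' k, ∫⁻ ζ, d k t ζ ∂circleMeasure := fun t => by
    have hdt : ∀ k, Measurable (d k t) := fun k => (hdm k).comp measurable_prodMk_left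
    rw [modulus_ofReal, modulus_ofReal, ← lintegral_tsum fun k => (hdt k).aemeasurable,
      ← lintegral_add_left (by fun_prop)]
    exact lintegral_mono fun ζ => hpt t ζ
  calc _ ≤ ∫⁻ t in Set.Ioo (0 : ℝ) 1,
        (modulus (fun ζ => (χ ζ : ℂ)) (Circle.exp t) / ENNReal.ofReal t +
          ∑' k, (∫⁻ ζ, d k t ζ ∂circleMeasure) / ENNReal.ofReal t) := by
        refine lintegral_mono fun t => ?_
        refine (ENNReal.div_le_div_right (hmod t) _).trans ?_
        rw [ENNReal.add_div]
        simp only [div_eq_mul_inv, ENNReal.tsum_mul_right]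
        exact le_rfl
    _ = (∫⁻ t in Set.Ioo (0 : ℝ) 1,
          modulus (fun ζ => (χ ζ : ℂ)) (Circle.exp t) / ENNReal.ofReal t) +
        ∑' k, ∫⁻ t in Set.Ioo (0 : ℝ) 1,
          (∫⁻ ζ, d k t ζ ∂circleMeasure) / ENNReal.ofReal t := by
        rw [lintegral_add_left (by fun_prop), lintegral_tsum]
        intro k
        have := hDm k
        exact (by fun_prop : Measurable _).aemeasurable
    _ ≤ _ + ∑' k, ε k := by
        gcongr with k
        exact hε k
    _ < ⊤ := ENNReal.add_lt_top.2 ⟨hd, hεtop.lt_top⟩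

/-- If `E` has positive measure and its indicator function satisfies the Dini condition, then some
compact set almost contained in `E` carries a nonzero density satisfying the Dini condition. The
density is `1_E · inf_k ramp u_k`, where `u_k` is the average of `1_E` at a sparse sequence of
scales, and the compact set is the intersection of the superlevel sets `{u_k ≥ 1/2}`. -/
theorem exists_isDini_of_compact {E : Set Circle} (hE : MeasurableSet E)
    (hd : IsDini (fun ζ => ((E.indicator 1 ζ : ℝ) : ℂ))) (hpos : circleMeasure E ≠ 0) :
    ∃ (K : Set Circle) (h : Circle → ℝ), IsCompact K ∧ circleMeasure (K \ E) = 0 ∧ Measurable h ∧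
      (∀ ζ, 0 ≤ h ζ) ∧ (∀ ζ, h ζ ≤ 1) ∧ (∀ ζ ∉ K, h ζ = 0) ∧ IsDini (fun ζ => (h ζ : ℂ)) ∧
      ∫ ζ, h ζ ∂circleMeasure ≠ 0 := by
  -- The total loss `4 ∑ ε k` has to stay below the measure of `E`.
  obtain ⟨ε, hε, hεsum⟩ := ENNReal.exists_pos_sum_of_countable'
    (ENNReal.div_pos hpos (by simp : (4 : ENNReal) ≠ ⊤)).ne' ℕ
  have hεtop : ∑' k, ε k ≠ ⊤ := hεsum.ne_top
  choose n hn1 hn2 using fun k => exists_dyadic_scale hd (hε k)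
  set χ : Circle → ℝ := E.indicator 1 with hχdef
  have hχ : Measurable χ := measurable_one.indicator hE
  have hχ0 : ∀ ζ, 0 ≤ χ ζ := fun ζ => Set.indicator_nonneg (fun _ _ => zero_le_one) ζ
  have hχ1 : ∀ ζ, χ ζ ≤ 1 := fun ζ => Set.indicator_le_self' (fun _ _ => zero_le_one) ζ
  set u : ℕ → Circle → ℝ := fun k => arcAverage χ ((1 / 2 : ℝ) ^ n k) with hu
  have huc : ∀ k, Continuous (u k) := fun k => continuous_arcAverage hχ hχ0 hχ1 (by positivity)
  have hu1 : ∀ k ζ, u k ζ ≤ 1 := fun k ζ => arcAverage_le_one hχ hχ0 hχ1 (by positivity) ζ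
  have hall := fun k => lintegral_ramp_arcAverage_le hE (n k) (hn1 k) (hn2 k)
  set V : Circle → ℝ := fun ζ => ⨅ k, ramp (u k ζ) with hV
  have hgm : ∀ k, Measurable fun ζ => ramp (u k ζ) := fun k =>
    (continuous_ramp.comp (huc k)).measurable
  have hVm : Measurable V := Measurable.iInf hgm
  have hbdd : ∀ ζ, BddBelow (Set.range fun k => ramp (u k ζ)) := fun ζ =>
    ⟨0, by rintro _ ⟨k, rfl⟩; exact ramp_nonneg _⟩
  have hV0 : ∀ ζ, 0 ≤ V ζ := fun ζ => le_ciInf fun k => ramp_nonneg _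
  have hVle : ∀ k ζ, V ζ ≤ ramp (u k ζ) := fun k ζ => ciInf_le (hbdd ζ) k
  have hV1 : ∀ ζ, V ζ ≤ 1 := fun ζ => (hVle 0 ζ).trans (ramp_le_one (hu1 0 ζ))
  refine ⟨⋂ k, {ζ | 1 / 2 ≤ u k ζ}, fun ζ => χ ζ * V ζ, ?_, ?_, hχ.mul hVm,
    fun ζ => mul_nonneg (hχ0 ζ) (hV0 ζ), fun ζ => mul_le_one₀ (hχ1 ζ) (hV0 ζ) (hV1 ζ), ?_, ?_, ?_⟩
  · exact (isClosed_iInter fun k => isClosed_le continuous_const (huc k)).isCompact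
  · have hle : ∀ k, circleMeasure ((⋂ k, {ζ | 1 / 2 ≤ u k ζ}) \ E) ≤ 4 * ε k := fun k => by
      calc circleMeasure ((⋂ k, {ζ | 1 / 2 ≤ u k ζ}) \ E)
          ≤ circleMeasure {ζ | (2⁻¹ : ENNReal) ≤ ‖u k ζ - χ ζ‖ₑ} := by
            refine measure_mono fun ζ hζ => ?_
            have h1 : 1 / 2 ≤ u k ζ := Set.mem_iInter.1 hζ.1 k
            have h2 : χ ζ = 0 := by simp [hχdef, hζ.2]
            change (2⁻¹ : ENNReal) ≤ ‖u k ζ - χ ζ‖ₑ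
            rw [h2, sub_zero, Real.enorm_of_nonneg (by linarith), ← ENNReal.ofReal_ofNat,
              ← ENNReal.ofReal_inv_of_pos (by norm_num)]
            exact ENNReal.ofReal_le_ofReal (by linarith)
        _ ≤ (∫⁻ ζ, ‖u k ζ - χ ζ‖ₑ ∂circleMeasure) / 2⁻¹ :=
            meas_ge_le_lintegral_div ((huc k).measurable.sub hχ).enorm.aemeasurable
              (by simp) (by simp)
        _ ≤ (2 * ε k) / 2⁻¹ := ENNReal.div_le_div_right (hall k).2.2 _
        _ = 4 * ε k := by
            rw [div_eq_mul_inv, inv_inv]; ring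
    have hlim : Tendsto (fun k => 4 * ε k) atTop (𝓝 0) := by
      have h1 := ENNReal.Tendsto.const_mul (a := 4)
        (ENNReal.tendsto_atTop_zero_of_tsum_ne_top hεtop) (Or.inr (by simp))
      simpa using h1
    exact le_antisymm (ge_of_tendsto' hlim hle) zero_le
  · intro ζ hζ
    simp only [Set.mem_iInter, not_forall] at hζ
    obtain ⟨k, hk⟩ := hζ
    have h1 : ramp (u k ζ) = 0 := ramp_eq_zero (not_le.1 hk).le
    have h2 : V ζ = 0 := le_antisymm (h1 ▸ hVle k ζ) (hV0 ζ)
    simp only [h2, mul_zero]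
  · set d : ℕ → ℝ → Circle → ENNReal := fun k t => {ζ | ζ ∈ E ∧ Circle.exp t * ζ ∈ E}.indicator
      (fun ζ => ‖ramp (u k (Circle.exp t * ζ)) - ramp (u k ζ)‖ₑ) with hdd
    have hdm : ∀ k, Measurable fun p : ℝ × Circle => d k p.1 p.2 := fun k => by
      have he := measurable_circle_exp
      have hgk := hgm k
      have hset : MeasurableSet {p : ℝ × Circle | p.2 ∈ E ∧ Circle.exp p.1 * p.2 ∈ E} :=
        (measurable_snd hE).inter
          ((by fun_prop : Measurable fun p : ℝ × Circle => Circle.exp p.1 * p.2) hE)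
      have hfun : Measurable fun p : ℝ × Circle =>
          ‖ramp (u k (Circle.exp p.1 * p.2)) - ramp (u k p.2)‖ₑ := by
        have hA : Measurable fun p : ℝ × Circle => ramp (u k (Circle.exp p.1 * p.2)) :=
          hgk.comp (by fun_prop)
        have hB : Measurable fun p : ℝ × Circle => ramp (u k p.2) := hgk.comp measurable_snd
        exact (hA.sub hB).enorm
      exact hfun.indicator hset
    have hpt : ∀ t ζ, ‖χ (Circle.exp t * ζ) * V (Circle.exp t * ζ) - χ ζ * V ζ‖ₑ ≤
        ‖χ (Circle.exp t * ζ) - χ ζ‖ₑ + ∑' k, d k t ζ := fun t ζ => by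
      by_cases h1 : ζ ∈ E <;> by_cases h2 : Circle.exp t * ζ ∈ E
      · have h3 : ∀ k, d k t ζ = ‖ramp (u k (Circle.exp t * ζ)) - ramp (u k ζ)‖ₑ := fun k =>
          Set.indicator_of_mem (s := {ζ | ζ ∈ E ∧ Circle.exp t * ζ ∈ E}) ⟨h1, h2⟩ _
        simp only [h3, hχdef, Set.indicator_of_mem h1, Set.indicator_of_mem h2, Pi.one_apply,
          one_mul]
        exact (enorm_iInf_sub_iInf_le (fun _ => ramp_nonneg _) fun _ => ramp_nonneg _).trans
          le_add_self
      · refine le_add_right ?_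
        simp only [hχdef, Set.indicator_of_mem h1, Set.indicator_of_notMem h2, Pi.one_apply,
          one_mul, zero_mul, zero_sub, enorm_neg]
        rw [Real.enorm_of_nonneg (hV0 ζ), enorm_one, ← ENNReal.ofReal_one]
        exact ENNReal.ofReal_le_ofReal (hV1 ζ)
      · refine le_add_right ?_
        simp only [hχdef, Set.indicator_of_mem h2, Set.indicator_of_notMem h1, Pi.one_apply,
          one_mul, zero_mul, sub_zero]
        rw [Real.enorm_of_nonneg (hV0 _), enorm_one, ← ENNReal.ofReal_one]
        exact ENNReal.ofReal_le_ofReal (hV1 _)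
      · simp [hχdef, h1, h2]
    exact isDini_of_le_tsum hχ hd hdm hpt (fun k => (hall k).1) (by
      rw [ENNReal.tsum_mul_left]
      exact ENNReal.mul_ne_top (by simp) hεtop)
  · intro hzero
    have hnn : ∀ ζ, 0 ≤ χ ζ * V ζ := fun ζ => mul_nonneg (hχ0 ζ) (hV0 ζ)
    have hint : Integrable (fun ζ => χ ζ * V ζ) circleMeasure :=
      Integrable.of_bound (C := 1) (hχ.mul hVm).aestronglyMeasurable
        (Eventually.of_forall fun ζ => by
          rw [Real.norm_of_nonneg (hnn ζ)]
          exact mul_le_one₀ (hχ1 ζ) (hV0 ζ) (hV1 ζ))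
    have hae := (integral_eq_zero_iff_of_nonneg hnn hint).1 hzero
    have h1 : circleMeasure E ≤ ∑' k, 4 * ε k := by
      calc circleMeasure E = ∫⁻ ζ, E.indicator 1 ζ ∂circleMeasure :=
            (lintegral_indicator_one hE).symm
        _ ≤ ∫⁻ ζ, ∑' k, E.indicator (fun ζ => ‖1 - ramp (u k ζ)‖ₑ) ζ ∂circleMeasure := by
            refine lintegral_mono_ae ?_
            filter_upwards [hae] with ζ hζ
            by_cases h : ζ ∈ E
            · simp only [Set.indicator_of_mem h, Pi.one_apply]
              have hVζ : V ζ = 0 := by simpa [hχdef, h] using hζ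
              have h2 := enorm_iInf_sub_iInf_le (f := fun _ => 1) (g := fun k => ramp (u k ζ))
                (fun _ => zero_le_one) fun _ => ramp_nonneg _
              rw [ciInf_const] at h2
              change ‖1 - V ζ‖ₑ ≤ _ at h2
              rwa [hVζ, sub_zero, enorm_one] at h2
            · simp [h]
        _ = ∑' k, ∫⁻ ζ, E.indicator (fun ζ => ‖1 - ramp (u k ζ)‖ₑ) ζ ∂circleMeasure := by
            refine lintegral_tsum fun k => ?_
            have := hgm k
            exact ((measurable_const.sub this).enorm.indicator hE).aemeasurable
        _ ≤ _ := ENNReal.tsum_le_tsum fun k => (hall k).2.1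
    rw [ENNReal.tsum_mul_left] at h1
    have h2 : 4 * ∑' k, ε k < 4 * (circleMeasure E / 4) :=
      (ENNReal.mul_lt_mul_iff_right (by simp) (by simp)).2 hεsum
    rw [ENNReal.mul_div_cancel (by simp) (by simp)] at h2
    exact absurd h1 (not_le.2 h2)

/-! ### Sets of finite entropy -/

theorem circleMeasure_circleTranslate (E : Set Circle) (t : ℝ) :
    circleMeasure (circleTranslate E t) = circleMeasure E := by
  rw [circleTranslate_eq_preimage, measure_preimage_mul]

/-- If `ξ`, `ζ` lie in a connected set `I` of the circle which contains neither `e^{-it}ξ` nor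
`e^{-it}ζ`, then `ζ` is within `t` of `ξ`: otherwise these two points separate `ξ` from `ζ`. The
separating function is `2 sin ((s + t) / 2) sin ((s - b + t) / 2)` at the point `e^{is}ξ`, where
`ζ = e^{ib}ξ`. -/
theorem abs_arg_le_of_isPreconnected {I : Set Circle} (hI : IsPreconnected I) {t : ℝ} (ht : 0 < t)
    (ht1 : t < 1) {ξ ζ : Circle} (hξ : ξ ∈ I) (hζ : ζ ∈ I) (hξ' : (Circle.exp t)⁻¹ * ξ ∉ I)
    (hζ' : (Circle.exp t)⁻¹ * ζ ∉ I) : |Complex.arg ((ξ⁻¹ * ζ : Circle) : ℂ)| ≤ t := by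
  have hpi := Real.pi_gt_three
  by_contra hlt
  rw [not_le] at hlt
  set b : ℝ := Complex.arg ((ξ⁻¹ * ζ : Circle) : ℂ) with hb
  have hζb : ζ = Circle.exp b * ξ := by
    rw [hb, Circle.exp_arg, mul_comm, mul_inv_cancel_left]
  have hbπ : |b| ≤ Real.pi := Complex.abs_arg_le_pi _
  set G : Circle → ℝ := fun z =>
    Real.cos (b / 2) - ((ξ⁻¹ * z * Circle.exp (-(b / 2 - t)) : Circle) : ℂ).re with hG
  have hGc : Continuous G := by
    refine continuous_const.sub (Complex.continuous_re.comp ?_)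
    exact (by fun_prop : Continuous fun z : Circle => (z : ℂ)).comp (by fun_prop)
  have hGexp : ∀ s : ℝ, G (Circle.exp s * ξ) =
      2 * Real.sin ((s + t) / 2) * Real.sin ((s - b + t) / 2) := fun s => by
    have h1 : ξ⁻¹ * (Circle.exp s * ξ) * Circle.exp (-(b / 2 - t)) =
        Circle.exp (s - (b / 2 - t)) := by
      rw [mul_comm (Circle.exp s), inv_mul_cancel_left, ← Circle.exp_add, ← sub_eq_add_neg]
    simp only [hG]
    rw [h1, Circle.coe_exp, Complex.exp_ofReal_mul_I_re, Real.cos_sub_cos,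
      show (b / 2 + (s - (b / 2 - t))) / 2 = (s + t) / 2 by ring,
      show (b / 2 - (s - (b / 2 - t))) / 2 = -((s - b + t) / 2) by ring, Real.sin_neg]
    ring
  have hne : ∀ z ∈ I, G z ≠ 0 := fun z hz h0 => by
    have hzs : z = Circle.exp (Complex.arg ((ξ⁻¹ * z : Circle) : ℂ)) * ξ := by
      rw [Circle.exp_arg, mul_comm, mul_inv_cancel_left]
    set s : ℝ := Complex.arg ((ξ⁻¹ * z : Circle) : ℂ)
    rw [hzs, hGexp] at h0
    rcases mul_eq_zero.1 h0 with h0 | h0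
    · have h1 := (mul_eq_zero.1 h0).resolve_left two_ne_zero
      obtain ⟨n, hn⟩ := Real.sin_eq_zero_iff.1 h1
      refine hξ' ?_
      rw [← Circle.exp_neg]
      convert hz using 1
      rw [hzs]
      congr 1
      exact Circle.exp_eq_exp.2 ⟨-n, by push_cast; linarith⟩
    · obtain ⟨n, hn⟩ := Real.sin_eq_zero_iff.1 h0
      refine hζ' ?_
      rw [← Circle.exp_neg, hζb, ← mul_assoc, ← Circle.exp_add]
      convert hz using 1
      rw [hzs]
      congr 1
      exact Circle.exp_eq_exp.2 ⟨-n, by push_cast; linarith⟩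
  have hsin : 0 < Real.sin (t / 2) := Real.sin_pos_of_pos_of_lt_pi (by linarith) (by linarith)
  have hGξ : G ξ = 2 * Real.sin (t / 2) * Real.sin ((t - b) / 2) := by
    have := hGexp 0
    rw [Circle.exp_zero, one_mul] at this
    rw [this]
    ring_nf
  have hGζ : G ζ = 2 * Real.sin ((b + t) / 2) * Real.sin (t / 2) := by
    rw [hζb, hGexp]
    ring_nf
  have hzero : ∃ z ∈ I, G z = 0 := by
    rcases lt_abs.1 hlt with h | h
    · rw [abs_of_pos (by linarith)] at hbπ
      have h1 : Real.sin ((t - b) / 2) < 0 :=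
        Real.sin_neg_of_neg_of_neg_pi_lt (by linarith) (by linarith)
      have h2 : 0 < Real.sin ((b + t) / 2) :=
        Real.sin_pos_of_pos_of_lt_pi (by linarith) (by linarith)
      refine hI.intermediate_value hξ hζ hGc.continuousOn ⟨?_, ?_⟩
      · rw [hGξ]; nlinarith
      · rw [hGζ]; positivity
    · rw [abs_of_neg (by linarith)] at hbπ
      have h1 : 0 < Real.sin ((t - b) / 2) :=
        Real.sin_pos_of_pos_of_lt_pi (by linarith) (by linarith)
      have h2 : Real.sin ((b + t) / 2) < 0 :=
        Real.sin_neg_of_neg_of_neg_pi_lt (by linarith) (by linarith)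
      refine hI.intermediate_value hζ hξ hGc.continuousOn ⟨?_, ?_⟩
      · rw [hGζ]; nlinarith
      · rw [hGξ]; positivity
  obtain ⟨z, hz, hz0⟩ := hzero
  exact hne z hz hz0

theorem circleMeasure_inter_circleTranslate_le {I K : Set Circle} (hI : IsPreconnected I)
    (hIK : Disjoint I K) {t : ℝ} (ht : 0 < t) (ht1 : t < 1) :
    circleMeasure (I ∩ circleTranslate K t) ≤ ENNReal.ofReal t := by
  rcases (I ∩ circleTranslate K t).eq_empty_or_nonempty with h | ⟨ξ, hξ, hξ'⟩
  · simp [h]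
  · refine (measure_mono fun ζ hζ => ?_).trans (circleMeasure_arc_le ht.le ξ)
    exact abs_arg_le_of_isPreconnected hI ht ht1 hξ hζ.1
      (fun h => hIK.le_bot ⟨h, mem_circleTranslate.1 hξ'⟩)
      (fun h => hIK.le_bot ⟨h, mem_circleTranslate.1 hζ.2⟩)

theorem pairwise_disjoint_complementaryArcs (K : Set Circle) :
    Pairwise (Function.onFun Disjoint fun I : complementaryArcs K => (I : Set Circle)) := by
  rintro ⟨I, ζ, hζ, rfl⟩ ⟨J, ξ, hξ, rfl⟩ hne
  refine Set.disjoint_left.2 fun z hz hz' => hne ?_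
  exact Subtype.ext ((connectedComponentIn_eq hz).trans (connectedComponentIn_eq hz').symm)

theorem isOpen_of_mem_complementaryArcs {K : Set Circle} (hK : IsClosed K) {I : Set Circle}
    (hI : I ∈ complementaryArcs K) : IsOpen I := by
  have : LocallyConnectedSpace Circle :=
    ChartedSpace.locallyConnectedSpace (EuclideanSpace ℝ (Fin 1)) Circle
  obtain ⟨ζ, -, rfl⟩ := hI
  exact hK.isOpen_compl.connectedComponentIn

theorem countable_complementaryArcs {K : Set Circle} (hK : IsClosed K) :
    Countable (complementaryArcs K) := by
  refine Set.PairwiseDisjoint.countable_of_isOpen (s := fun I : Set Circle => I)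
    (fun I hI J hJ hne => ?_) (fun I hI => isOpen_of_mem_complementaryArcs hK hI) fun I hI => ?_
  · exact pairwise_disjoint_complementaryArcs K
      (i := ⟨I, hI⟩) (j := ⟨J, hJ⟩) fun h => hne (congrArg Subtype.val h)
  · obtain ⟨ζ, hζ, rfl⟩ := hI
    exact ⟨ζ, mem_connectedComponentIn hζ⟩

/-- A point of `K + t` outside `K` lies in a complementary arc and within `t` of its end. -/
theorem circleMeasure_symmDiff_circleTranslate_le {K : Set Circle} (hK : IsClosed K) {t : ℝ}
    (ht : 0 < t) (ht1 : t < 1) :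
    circleMeasure (symmDiff (circleTranslate K t) K) ≤
      2 * ∑' I : complementaryArcs K, min (circleMeasure (I : Set Circle)) (ENNReal.ofReal t) := by
  have := countable_complementaryArcs hK
  have hKm := hK.measurableSet
  have hTm : MeasurableSet (circleTranslate K t) := by
    rw [circleTranslate_eq_preimage]; exact (measurable_const_mul _) hKm
  have h1 : circleMeasure (circleTranslate K t \ K) ≤
      ∑' I : complementaryArcs K, min (circleMeasure (I : Set Circle)) (ENNReal.ofReal t) := by
    calc _ ≤ circleMeasure (⋃ I : complementaryArcs K, (I : Set Circle) ∩ circleTranslate K t) := by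
          refine measure_mono fun ζ hζ => Set.mem_iUnion.2
            ⟨⟨connectedComponentIn Kᶜ ζ, ζ, hζ.2, rfl⟩, mem_connectedComponentIn hζ.2, hζ.1⟩
      _ ≤ _ := (measure_iUnion_le _).trans (ENNReal.tsum_le_tsum fun I => ?_)
    refine le_min (measure_mono Set.inter_subset_left) ?_
    obtain ⟨I, ζ, hζ, rfl⟩ := I
    exact circleMeasure_inter_circleTranslate_le isPreconnected_connectedComponentIn
      (Set.disjoint_left.2 fun z hz hz' => connectedComponentIn_subset Kᶜ ζ hz hz') ht ht1
  have h2 : circleMeasure (K \ circleTranslate K t) = circleMeasure (circleTranslate K t \ K) := by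
    have h3 := measure_inter_add_sdiff (μ := circleMeasure) K hTm
    have h4 := measure_inter_add_sdiff (μ := circleMeasure) (circleTranslate K t) hKm
    rw [circleMeasure_circleTranslate, ← h3, Set.inter_comm] at h4
    exact ((ENNReal.add_right_inj (measure_ne_top _ _)).1 h4).symm
  calc _ ≤ circleMeasure (circleTranslate K t \ K) + circleMeasure (K \ circleTranslate K t) :=
        measure_union_le _ _
    _ ≤ _ := by rw [h2, two_mul]; gcongr

theorem lintegral_min_div_le {l : ℝ} (hl0 : 0 ≤ l) (hl1 : l ≤ 1) :
    ∫⁻ t in Set.Ioo (0 : ℝ) 1, min (ENNReal.ofReal l) (ENNReal.ofReal t) / ENNReal.ofReal t ≤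
      ENNReal.ofReal l + ENNReal.ofReal (l * Real.log (1 / l)) := by
  rcases hl0.eq_or_lt with rfl | hl
  · simp
  have hsplit : Set.Ioo (0 : ℝ) 1 ⊆ Set.Ioo 0 l ∪ Set.Ico l 1 := fun t ht => by
    rcases lt_or_ge t l with h | h
    · exact Or.inl ⟨ht.1, h⟩
    · exact Or.inr ⟨h, ht.2⟩
  refine (lintegral_mono_set hsplit).trans ((lintegral_union_le _ _ _).trans ?_)
  gcongr ?_ + ?_
  · calc _ ≤ ∫⁻ _ in Set.Ioo (0 : ℝ) l, 1 :=
          lintegral_mono fun t => (ENNReal.div_le_div_right (min_le_right _ _) _).trans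
            ENNReal.div_self_le_one
      _ = _ := by simp
  · calc _ ≤ ∫⁻ t in Set.Ico l 1, ENNReal.ofReal l * (ENNReal.ofReal t)⁻¹ :=
          lintegral_mono fun t => by
            rw [div_eq_mul_inv]
            gcongr
            exact min_le_left _ _
      _ = _ := by
          rw [lintegral_const_mul' _ _ ENNReal.ofReal_ne_top, lintegral_inv_Ico hl hl1,
            ← ENNReal.ofReal_mul hl0]

theorem translationIntegral_lt_top_of_hasFiniteEntropy {K : Set Circle} (hK : HasFiniteEntropy K) :
    translationIntegral K < ⊤ := by
  obtain ⟨hKc, hsum⟩ := hK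
  have hcl := hKc.isClosed
  have := countable_complementaryArcs hcl
  have hone : ∑' I : complementaryArcs K, circleMeasure (I : Set Circle) ≤ 1 := by
    rw [← measure_iUnion (pairwise_disjoint_complementaryArcs K)
      fun I => (isOpen_of_mem_complementaryArcs hcl I.2).measurableSet]
    exact prob_le_one
  have hreal : ∀ I : Set Circle, circleMeasure I = ENNReal.ofReal (circleMeasure.real I) := fun I =>
    (ENNReal.ofReal_toReal (measure_ne_top _ _)).symm
  calc translationIntegral K
      ≤ ∫⁻ t in Set.Ioo (0 : ℝ) 1, 2 * ∑' I : complementaryArcs K,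
          min (ENNReal.ofReal (circleMeasure.real (I : Set Circle))) (ENNReal.ofReal t) /
            ENNReal.ofReal t := by
        refine setLIntegral_mono' measurableSet_Ioo fun t ht => ?_
        simp only [div_eq_mul_inv, ENNReal.tsum_mul_right, ← mul_assoc, ← hreal]
        gcongr
        exact circleMeasure_symmDiff_circleTranslate_le hcl ht.1 ht.2
    _ = 2 * ∑' I : complementaryArcs K, ∫⁻ t in Set.Ioo (0 : ℝ) 1,
          min (ENNReal.ofReal (circleMeasure.real (I : Set Circle))) (ENNReal.ofReal t) /
            ENNReal.ofReal t := by
        rw [lintegral_const_mul' _ _ (by simp), lintegral_tsum fun I => by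
          apply Measurable.aemeasurable; fun_prop]
    _ ≤ 2 * ∑' I : complementaryArcs K, (circleMeasure (I : Set Circle) +
          ENNReal.ofReal (circleMeasure.real (I : Set Circle) *
            Real.log (1 / circleMeasure.real (I : Set Circle)))) := by
        gcongr with I
        rw [hreal (I : Set Circle)]
        exact lintegral_min_div_le measureReal_nonneg measureReal_le_one
    _ < ⊤ := by
        rw [ENNReal.tsum_add]
        exact ENNReal.mul_lt_top (by simp)
          (ENNReal.add_lt_top.2 ⟨hone.trans_lt ENNReal.one_lt_top, hsum⟩)

/-! ### Null measurable sets -/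

theorem translationIntegral_congr {E F : Set Circle} (h : E =ᵐ[circleMeasure] F) :
    translationIntegral E = translationIntegral F := by
  refine lintegral_congr fun t => ?_
  congr 1
  refine measure_congr (EventuallyEq.symmDiff ?_ h)
  rw [circleTranslate_eq_preimage, circleTranslate_eq_preimage]
  exact (measurePreserving_mul_left circleMeasure _).quasiMeasurePreserving.preimage_ae_eq h

theorem isSetOfRigidity_congr {E F : Set Circle} (h : E =ᵐ[circleMeasure] F) :
    IsSetOfRigidity E ↔ IsSetOfRigidity F := by
  unfold IsSetOfRigidity MemPolyClosure
  rw [Measure.restrict_congr_set h]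

theorem exists_not_isRemovable {E : Set Circle} (hE : MeasurableSet E)
    (ht : translationIntegral E < ⊤) (hpos : circleMeasure E ≠ 0) :
    ∃ K : Set Circle, IsCompact K ∧ AlmostContained K E ∧
      ¬ IsRemovable ((fun ζ : Circle => (ζ : ℂ)) '' K) := by
  have hd := (isDini_indicator_iff hE).2 ht
  have heq : (E.indicator 1 : Circle → ℂ) = fun ζ => ((E.indicator 1 ζ : ℝ) : ℂ) := by
    ext ζ
    by_cases h : ζ ∈ E <;> simp [h]
  rw [heq] at hd
  obtain ⟨K, h, hK, hKE, hm, h0, h1, hoff, hdini, hint⟩ := exists_isDini_of_compact hE hd hpos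
  refine ⟨K, hK, hKE, not_isRemovable_of_isDini_of_integral_ne_zero (φ := fun ζ => (h ζ : ℂ))
    (C := 1) (by fun_prop) (fun ζ => ?_) hdini ?_ hK fun ζ hζ => by simp [hoff ζ hζ]⟩
  · rw [Complex.norm_real, Real.norm_of_nonneg (h0 ζ)]; exact h1 ζ
  · rw [integral_complex_ofReal]; exact_mod_cast hint

theorem not_isRemovable_of_isCompact {K : Set Circle} (hK : IsCompact K)
    (ht : translationIntegral K < ⊤) (hpos : circleMeasure K ≠ 0) :
    ¬ IsRemovable ((fun ζ : Circle => (ζ : ℂ)) '' K) := by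
  have hKm := hK.isClosed.measurableSet
  refine not_isRemovable_of_isDini_of_integral_ne_zero (φ := K.indicator 1) (C := 1)
    (measurable_one.indicator hKm) (fun ζ => ?_) ((isDini_indicator_iff hKm).2 ht) ?_ hK
    fun ζ hζ => Set.indicator_of_notMem hζ _
  · by_cases h : ζ ∈ K <;> simp [h]
  · rw [integral_indicator hKm]
    simpa [measureReal_eq_zero_iff] using hpos

end BlochRigidity

theorem proposition2p6 :
    (∀ E : Set Circle, NullMeasurableSet E BlochRigidity.circleMeasure →
      BlochRigidity.translationIntegral E < ⊤ →
        (BlochRigidity.circleMeasure E ≠ 0 →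
          ∃ K : Set Circle, IsCompact K ∧ BlochRigidity.AlmostContained K E ∧
            ¬ BlochRigidity.IsRemovable ((fun ζ : Circle => (ζ : ℂ)) '' K)) ∧
        BlochRigidity.IsSetOfRigidity E) ∧
    (∀ K : Set Circle, BlochRigidity.HasFiniteEntropy K →
      BlochRigidity.translationIntegral K < ⊤ ∧
      (BlochRigidity.circleMeasure K ≠ 0 →
        ¬ BlochRigidity.IsRemovable ((fun ζ : Circle => (ζ : ℂ)) '' K)) ∧
      BlochRigidity.IsSetOfRigidity K) := by
  refine ⟨fun E hE ht => ?_, fun K hK => ?_⟩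
  · obtain ⟨F, -, hF, hFE⟩ := hE.exists_measurable_superset_ae_eq
    rw [← BlochRigidity.translationIntegral_congr hFE] at ht
    refine ⟨fun hpos => ?_, (BlochRigidity.isSetOfRigidity_congr hFE).1
      (BlochRigidity.isSetOfRigidity_of_measurableSet hF ht)⟩
    rw [← measure_congr hFE] at hpos
    obtain ⟨K, hK, hKF, hrem⟩ := BlochRigidity.exists_not_isRemovable hF ht hpos
    refine ⟨K, hK, ?_, hrem⟩
    rw [BlochRigidity.AlmostContained] at hKF ⊢
    rwa [← measure_congr (EventuallyEq.rfl.diff hFE)]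
  · have ht := BlochRigidity.translationIntegral_lt_top_of_hasFiniteEntropy hK
    exact ⟨ht, BlochRigidity.not_isRemovable_of_isCompact hK.1 ht,
      BlochRigidity.isSetOfRigidity_of_measurableSet hK.1.isClosed.measurableSet ht⟩
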